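/- Let $1<p<\infty$, $p'=p/(p-1)$, and let $v_0,v_1\ge 0$ be functions in $L^p_{\rm loc}(0,\infty)$, neither of them a.e. zero, with $1/v_1\in L^{p'}_{\rm loc}(0,\infty)$ (in particular $v_1>0$ a.e.). Suppose that there is a $c\in(0,\infty)$ with $$\|v_1^{-1}\|_{L^{p'}(0,c)}\|v_0\|_{L^p(0,c)}=\|v_1^{-1}\|_{L^{p'}(c,\infty)}\|v_0\|_{L^p(c,\infty)}=\infty ,$$ where $0\cdot\infty=0$. Functions on $(0,\infty)$ are real-valued and identified when they agree a.e. For a space $X$ of measurable functions on $(0,\infty)$ with norm $\|\cdot\|_X$ and measurable $g$ put $$\mathbf J_X(g)=\sup_{0\ne f\in X}\frac{\int_0^\infty|fg|}{\|f\|_X},\qquad J_X(g)=\sup_{0\neq f\in X}\frac{\bigl|\int_0^\infty fg\bigr|}{\|f\|_X},$$ the second one for those $g$ with $\int_0^\infty|fg|<\infty$ for all $f\in X$. The strong associate space $X'_s$ consists of the measurable $g$ with $\|g\|_{X'_s}:=\mathbf J_X(g)<\infty$. The weak associate space $X'_w$ consists of the measurable $g$ such that $\int_0^\infty|fg|<\infty$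 for all $f\in X$ and $\|g\|_{X'_w}:=J_X(g)<\infty$. (0) For every $t>0$ there is exactly one pair $(a(t),b(t))$ with $0<a(t)<t<b(t)<\infty$, $$\int_{a(t)}^t v_1^{-p'}=\int_t^{b(t)}v_1^{-p'},\qquad \Bigl(\int_{a(t)}^{b(t)}v_1^{-p'}\Bigr)^{1/p'}\Bigl(\int_{a(t)}^{b(t)}v_0^p\Bigr)^{1/p}=1 .$$ Let $V_1(t)=\int_{a(t)}^{b(t)}v_1^{-p'}$, let $a^{-1}(t)=\sup\{x>0: a(x)<t\}\in(0,\infty]$ (the inverse function of $a$ on the range of $a$), and let $\mathscr W_{p',1/v_1}$ be the space of all $g\in L^1_{\rm loc}(0,\infty)$ for which the inner integrals below exist for every $t>0$ as Lebesgue integrals (automatic when $a^{-1}(t)<\infty$) and $\|g\|_{\mathscr W_{p',1/v_1}}:=\mathbb G(g)+\mathcal G(g)<\infty$, where $$\mathbb G(g)=\biggl(\int_0^\infty v_1^{-p'}(t)\biggl|\int_t^{a^{-1}(t)}\frac{g(x)}{V_1(x)}\Bigl(\int_{a(x)}^tv_1^{-p'}\Bigr)dx\biggr|^{p'}dt\biggr)^{1/p'},$$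 $$\mathcal G(g)=\biggl(\int_0^\infty v_1^{-p'}(t)V_1^{p'}(t)\biggl|\int_t^{a^{-1}(t)}\frac{g(x)}{V_1(x)}dx\biggr|^{p'}dt\biggr)^{1/p'}.$$ (1) If $f$ is measurable on $(0,\infty)$ and ${\rm meas}\{x\in(0,\infty): f(x)\ne0\}>0$, then $\mathbf J_{\mathscr W_{p',1/v_1}}(f)=\infty$. (2) Let $X$ be the space of all locally absolutely continuous functions $f$ on $(0,\infty)$ with $f(0)=0$, with compact support in $(0,\infty)$ and with $\|f\|_X:=\|v_0f\|_{L^p(0,\infty)}+\|v_1f'\|_{L^p(0,\infty)}<\infty$. Then $[X'_w]'_s=\{0\}$. -/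

import Mathlib

open MeasureTheory Set
open scoped ENNReal

noncomputable section

namespace WeightedSobolev

/-! Functions on the half-line `(0,∞)` are represented by functions `ℝ → ℝ`, considered up to
equality almost everywhere with respect to the following measure. -/

/-- Lebesgue measure on `(0,∞)`. -/
abbrev halfLine : Measure ℝ := volume.restrict (Ioi (0 : ℝ))

/-- `u ∈ L^r_loc(0,∞)`. -/
def LpLoc (r : ℝ) (u : ℝ → ℝ) : Prop :=
  ∀ K : Set ℝ, IsCompact K → K ⊆ Ioi 0 → MemLp u (ENNReal.ofReal r) (volume.restrict K)

/-- The class of weights: nonnegative functions in `L^p_loc(0,∞)` that are not a.e. zero. -/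
def IsWeight (p : ℝ) (v : ℝ → ℝ) : Prop :=
  LpLoc p v ∧ (∀ᵐ x ∂halfLine, 0 ≤ v x) ∧ ¬ v =ᵐ[halfLine] 0

/-- `1/v ∈ L^r_loc(0,∞)`. Since `1/0 = ∞` in the usual sense, this includes that `v` is positive
almost everywhere; that has to be said, because `0⁻¹ = 0` for real numbers in Lean. -/
def InvLpLoc (r : ℝ) (v : ℝ → ℝ) : Prop :=
  (∀ᵐ x ∂halfLine, 0 < v x) ∧ LpLoc r (fun x => (v x)⁻¹)

/-- For some `c ∈ (0,∞)` the products `‖1/v₁‖_{p'} ‖v₀‖_p` over `(0,c)` and over `(c,∞)` are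
infinite (with `0 · ∞ = 0`, as always in `ℝ≥0∞`). -/
def BothEndsInfinite (p : ℝ) (v₀ v₁ : ℝ → ℝ) : Prop :=
  ∃ c : ℝ, 0 < c ∧
    eLpNorm (fun x => (v₁ x)⁻¹) (ENNReal.ofReal p.conjExponent) (volume.restrict (Ioo 0 c)) *
      eLpNorm v₀ (ENNReal.ofReal p) (volume.restrict (Ioo 0 c)) = ∞ ∧
    eLpNorm (fun x => (v₁ x)⁻¹) (ENNReal.ofReal p.conjExponent) (volume.restrict (Ioi c)) *
      eLpNorm v₀ (ENNReal.ofReal p) (volume.restrict (Ioi c)) = ∞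

/-! ### Associate spaces

A space of functions is given by the set `X` of its elements and its norm `N`. The conventions
`0 / 0 = 0` and `∞ / ∞ = 0` hold in `ℝ≥0∞`. -/

/-- The strong functional `sup_{0 ≠ f ∈ X} ∫ |f g| / ‖f‖`. -/
def strongFunctional (X : Set (ℝ → ℝ)) (N : (ℝ → ℝ) → ℝ≥0∞) (g : ℝ → ℝ) : ℝ≥0∞ :=
  ⨆ f ∈ {f ∈ X | ¬ f =ᵐ[halfLine] 0}, (∫⁻ x, ‖f x * g x‖ₑ ∂halfLine) / N f

/-- The weak functional `sup_{0 ≠ f ∈ X} |∫ f g| / ‖f‖`; it is used for `g ∈ pairingDomain X`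
only. -/
def weakFunctional (X : Set (ℝ → ℝ)) (N : (ℝ → ℝ) → ℝ≥0∞) (g : ℝ → ℝ) : ℝ≥0∞ :=
  ⨆ f ∈ {f ∈ X | ¬ f =ᵐ[halfLine] 0}, ‖∫ x, f x * g x ∂halfLine‖ₑ / N f

/-- The measurable `g` such that `∫ |f g| < ∞` for all `f ∈ X`. -/
def pairingDomain (X : Set (ℝ → ℝ)) : Set (ℝ → ℝ) :=
  {g | AEMeasurable g halfLine ∧ ∀ f ∈ X, ∫⁻ x, ‖f x * g x‖ₑ ∂halfLine < ∞}

/-- The strong associate space `X'_s`, with norm `strongFunctional X N`. (Finiteness of the strong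
functional forces `g` into `pairingDomain X` as soon as the norm is finite on `X`.) -/
def strongAssociate (X : Set (ℝ → ℝ)) (N : (ℝ → ℝ) → ℝ≥0∞) : Set (ℝ → ℝ) :=
  {g | AEMeasurable g halfLine ∧ strongFunctional X N g < ∞}

/-- The weak associate space `X'_w`, with norm `weakFunctional X N`. -/
def weakAssociate (X : Set (ℝ → ℝ)) (N : (ℝ → ℝ) → ℝ≥0∞) : Set (ℝ → ℝ) :=
  {g | g ∈ pairingDomain X ∧ weakFunctional X N g < ∞}

/-! ### The Sobolev space of compactly supported functions -/

/-- `‖v₀ u‖_p + ‖v₁ Du‖_p` over `(0,∞)`. It is used for locally absolutely continuous `u`, whose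
distributional derivative is its pointwise a.e. derivative. -/
def sobolevNorm (p : ℝ) (v₀ v₁ u : ℝ → ℝ) : ℝ≥0∞ :=
  eLpNorm (fun x => v₀ x * u x) (ENNReal.ofReal p) halfLine +
    eLpNorm (fun x => v₁ x * deriv u x) (ENNReal.ofReal p) halfLine

/-- The locally absolutely continuous functions on `(0,∞)` with compact support in `(0,∞)`
(extended by zero) and finite Sobolev norm. -/
def sobolevCompact (p : ℝ) (v₀ v₁ : ℝ → ℝ) : Set (ℝ → ℝ) :=
  {f | (∀ s t : ℝ, 0 < s → s < t → AbsolutelyContinuousOnInterval f s t) ∧ f 0 = 0 ∧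
    HasCompactSupport f ∧ tsupport f ⊆ Ioi 0 ∧ sobolevNorm p v₀ v₁ f < ∞}

/-! ### The functions `a`, `b` and the space `𝒲_{p', 1/v₁}` -/

/-- `0 < α < t < β`, the equilibrium condition `∫_α^t v₁^{-p'} = ∫_t^β v₁^{-p'}`, and
`(∫_α^β v₁^{-p'})^{1/p'} (∫_α^β v₀^p)^{1/p} = 1`. -/
def IsEquilibriumPair (p : ℝ) (v₀ v₁ : ℝ → ℝ) (t α β : ℝ) : Prop :=
  0 < α ∧ α < t ∧ t < β ∧
  ∫ x in α..t, v₁ x ^ (-p.conjExponent) = ∫ x in t..β, v₁ x ^ (-p.conjExponent) ∧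
  (∫ x in α..β, v₁ x ^ (-p.conjExponent)) ^ (1 / p.conjExponent) *
    (∫ x in α..β, v₀ x ^ p) ^ (1 / p) = 1

/-- The pair `(a(t), b(t))`. -/
def equilibriumPair (p : ℝ) (v₀ v₁ : ℝ → ℝ) (t : ℝ) : ℝ × ℝ :=
  Classical.epsilon fun q : ℝ × ℝ => IsEquilibriumPair p v₀ v₁ t q.1 q.2

/-- The left end `a(t)`. -/
def eqA (p : ℝ) (v₀ v₁ : ℝ → ℝ) (t : ℝ) : ℝ := (equilibriumPair p v₀ v₁ t).1

/-- The right end `b(t)`. -/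
def eqB (p : ℝ) (v₀ v₁ : ℝ → ℝ) (t : ℝ) : ℝ := (equilibriumPair p v₀ v₁ t).2

/-- The inverse function of the increasing function `a`, as `sup {x > 0 : a(x) < t}`
(equal to `∞` if `t` lies above the range of `a`). -/
def eqAInv (p : ℝ) (v₀ v₁ : ℝ → ℝ) (t : ℝ) : EReal :=
  ⨆ x ∈ {x : ℝ | 0 < x ∧ eqA p v₀ v₁ x < t}, (x : EReal)

/-- The interval `(t, a⁻¹(t))`. -/
def forwardInterval (p : ℝ) (v₀ v₁ : ℝ → ℝ) (t : ℝ) : Set ℝ :=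
  {x : ℝ | t < x ∧ (x : EReal) < eqAInv p v₀ v₁ t}

/-- `V₁(t) = ∫_{a(t)}^{b(t)} v₁^{-p'}`. -/
def bigV (p : ℝ) (v₀ v₁ : ℝ → ℝ) (t : ℝ) : ℝ :=
  ∫ x in (eqA p v₀ v₁ t)..(eqB p v₀ v₁ t), v₁ x ^ (-p.conjExponent)

/-- `g(x) / V₁(x) · ∫_{a(x)}^t v₁^{-p'}`. -/
def bbIntegrand (p : ℝ) (v₀ v₁ g : ℝ → ℝ) (t x : ℝ) : ℝ :=
  g x / bigV p v₀ v₁ x * ∫ y in (eqA p v₀ v₁ x)..t, v₁ y ^ (-p.conjExponent)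

/-- `g(x) / V₁(x)`. -/
def calIntegrand (p : ℝ) (v₀ v₁ g : ℝ → ℝ) (x : ℝ) : ℝ :=
  g x / bigV p v₀ v₁ x

/-- The functional `𝔾(g)`. -/
def bbG (p : ℝ) (v₀ v₁ g : ℝ → ℝ) : ℝ≥0∞ :=
  (∫⁻ t, ENNReal.ofReal (v₁ t ^ (-p.conjExponent) *
    |∫ x in forwardInterval p v₀ v₁ t, bbIntegrand p v₀ v₁ g t x| ^ p.conjExponent)
      ∂halfLine) ^ (1 / p.conjExponent)

/-- The functional `𝒢(g)`. -/
def calG (p : ℝ) (v₀ v₁ g : ℝ → ℝ) : ℝ≥0∞ :=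
  (∫⁻ t, ENNReal.ofReal (v₁ t ^ (-p.conjExponent) * bigV p v₀ v₁ t ^ p.conjExponent *
    |∫ x in forwardInterval p v₀ v₁ t, calIntegrand p v₀ v₁ g x| ^ p.conjExponent)
      ∂halfLine) ^ (1 / p.conjExponent)

/-- The norm `𝔾(g) + 𝒢(g)`. -/
def scrWNorm (p : ℝ) (v₀ v₁ g : ℝ → ℝ) : ℝ≥0∞ :=
  bbG p v₀ v₁ g + calG p v₀ v₁ g

/-- The space `𝒲_{p', 1/v₁}` of all `g ∈ L¹_loc(0,∞)` with `𝔾(g) + 𝒢(g) < ∞`. The integrability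
clause says that the inner integrals exist; it holds for every `g ∈ L¹_loc(0,∞)` if `a⁻¹(t) < ∞`
for all `t > 0`, as the closure of `(t, a⁻¹(t))` is then compact in `(0,∞)`. -/
def scrW (p : ℝ) (v₀ v₁ : ℝ → ℝ) : Set (ℝ → ℝ) :=
  {g | LocallyIntegrableOn g (Ioi 0) volume ∧
    (∀ t : ℝ, 0 < t → IntegrableOn (bbIntegrand p v₀ v₁ g t) (forwardInterval p v₀ v₁ t) ∧
      IntegrableOn (calIntegrand p v₀ v₁ g) (forwardInterval p v₀ v₁ t)) ∧
    scrWNorm p v₀ v₁ g < ∞}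

end WeightedSobolev

end

/-! Equilibrium pairs. Put `w = v₁^{-p'}` and `u = v₀^p`. Balanced intervals around `t` form a
one-parameter family, indexed by the `w`-mass `h` of either half, and the product of norms varies
continuously with `h`, starting from zero. An infinite product at both ends makes it reach one, so
the intermediate value theorem gives a pair (`exists_equilibriumPair`). If two pairs at points `s ≤
t` were out of order, balance would force their intervals to be nested, and nested intervals with
product one coincide (`eq_of_nested`). This yields uniqueness and the monotonicity of `a` and `b`.

Dual statements. Both rest on the fact that the norms of `𝒲` and of `X'_w` are weak (the modulus
stands outside an integral of `g`), while the strong functional sees `|g|`. Given `f` that is not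
a.e. zero, choose a bounded set `E` of positive measure, away from `0`, on which `|f| ≥ δ > 0`. Let
`g_n` be `cos (n x)` on `E` minus its mean. By the Riemann–Lebesgue lemma `g_n → 0` weakly, yet `∫
|g_n|` stays above a positive constant, hence so does `∫ |f g_n|`. It remains to see that the norms
of `g_n` tend to zero; then `strongFunctional_eq_top` applies.

For `X'_w`, integration by parts and Hölder's inequality bound the norm by a weighted `L^{p'}` norm
of the primitive of `g_n` (`weakFunctional_oscillation_le`). For `𝒲`, the inner integrals pair `g_n`
with kernels bounded on `E` and vanishing for `t` outside a compact interval
(`tendsto_kernel_functional`). In both cases there is pointwise convergence to zero, and dominated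
convergence concludes. -/

namespace WeightedSobolev

open Filter Topology

/-! ### Equilibrium pairs for general densities: uniqueness, monotonicity, intermediate values. -/

section

/-- A locally integrable density on `(0,∞)`, all of whose integrals over intervals are
nonnegative. -/
structure LocDensity (w : ℝ → ℝ) : Prop where
  integrable : ∀ {s t : ℝ}, 0 < s → 0 < t → IntervalIntegrable w volume s t
  nonneg : ∀ {s t : ℝ}, 0 < s → s ≤ t → 0 ≤ ∫ x in s..t, w x

/-- A locally integrable density on `(0,∞)` with positive integrals over all intervals. -/
structure PosLocDensity (w : ℝ → ℝ) : Prop extends LocDensity w where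
  pos : ∀ {s t : ℝ}, 0 < s → s < t → 0 < ∫ x in s..t, w x

/-- The equilibrium condition for general densities. -/
def EquilibriumPair (q p : ℝ) (w u : ℝ → ℝ) (t α β : ℝ) : Prop :=
  0 < α ∧ α < t ∧ t < β ∧ ∫ x in α..t, w x = ∫ x in t..β, w x ∧
    (∫ x in α..β, w x) ^ (1 / q) * (∫ x in α..β, u x) ^ (1 / p) = 1

variable {w u : ℝ → ℝ} {q p : ℝ}

theorem LocDensity.add (hw : LocDensity w) {a b c : ℝ} (ha : 0 < a) (hb : 0 < b) (hc : 0 < c) :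
    (∫ x in a..b, w x) + ∫ x in b..c, w x = ∫ x in a..c, w x :=
  intervalIntegral.integral_add_adjacent_intervals (hw.integrable ha hb) (hw.integrable hb hc)

theorem LocDensity.mono (hw : LocDensity w) {a b c d : ℝ} (ha : 0 < a) (hab : a ≤ b) (hbc : b ≤ c)
    (hcd : c ≤ d) : ∫ x in b..c, w x ≤ ∫ x in a..d, w x := by
  have hb := ha.trans_le hab
  have hc := hb.trans_le hbc
  have hd := hc.trans_le hcd
  have h1 := hw.add ha hb hd
  have h2 := hw.add hb hc hd
  linarith [hw.nonneg ha hab, hw.nonneg hc hcd]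

theorem LocDensity.continuousOn (hw : LocDensity w) {t : ℝ} (ht : 0 < t) :
    ContinuousOn (fun x => ∫ y in t..x, w y) (Ioi 0) := by
  intro x hx
  have hx : 0 < x := hx
  have h := intervalIntegral.continuousOn_primitive_interval (μ := volume) (f := w)
    (a := min t x / 2) (b := x + 1)
    (by
      rw [← intervalIntegrable_iff']
      exact hw.integrable (by positivity) (by positivity))
  have hm : min t x / 2 < x := by
    have := min_le_right t x
    linarith
  have h2 : ContinuousAt (fun z => ∫ y in (min t x / 2)..z, w y) x := by
    refine h.continuousAt ?_
    rw [uIcc_of_le (by linarith)]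
    exact Icc_mem_nhds hm (by linarith)
  have h3 : ContinuousAt (fun z => (∫ y in t..(min t x / 2), w y)
      + ∫ y in (min t x / 2)..z, w y) x := continuousAt_const.add h2
  refine (h3.congr ?_).continuousWithinAt
  filter_upwards [Ioi_mem_nhds hx] with z hz
  exact hw.add ht (by positivity) hz

theorem PosLocDensity.strictMonoOn (hw : PosLocDensity w) {t : ℝ} (ht : 0 < t) :
    StrictMonoOn (fun x => ∫ y in t..x, w y) (Ioi 0) := by
  intro x hx y hy hxy
  have := hw.add ht hx hy
  have := hw.pos hx hxy
  simp only
  linarith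

/-- Two nested intervals on both of which the product equals one coincide. -/
theorem eq_of_nested (hq : 0 < q) (hp : 0 < p) (hw : PosLocDensity w) (hu : LocDensity u)
    {α β α' β' : ℝ} (hα : 0 < α) (h1 : α ≤ α') (h2 : α' < β') (h3 : β' ≤ β)
    (h : (∫ x in α..β, w x) ^ (1 / q) * (∫ x in α..β, u x) ^ (1 / p) = 1)
    (h' : (∫ x in α'..β', w x) ^ (1 / q) * (∫ x in α'..β', u x) ^ (1 / p) = 1) :
    α = α' ∧ β' = β := by
  have hα' := hα.trans_le h1
  have hβ' := hα'.trans h2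
  have hβ := hβ'.trans_le h3
  -- If the outer interval had more `w`-mass, its product would be strictly larger, because the
  -- inner `u`-factor is nonzero (the inner product is one). Equal `w`-masses then leave no room at
  -- the ends, `w` having positive integrals.
  have hle : ∫ x in α..β, w x ≤ ∫ x in α'..β', w x := by
    by_contra! hlt
    have hw' := hw.pos hα' h2
    have hu' := hu.nonneg hα' h2.le
    have hU := hu.mono hα h1 h2.le h3
    have e1 := Real.rpow_lt_rpow hw'.le hlt (one_div_pos.2 hq)
    have e2 := Real.rpow_le_rpow hu' hU (one_div_pos.2 hp).le
    have e3 : 0 < (∫ x in α'..β', u x) ^ (1 / p) := by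
      refine (Real.rpow_nonneg hu' _).lt_of_ne' fun h0 => ?_
      rw [h0] at h'
      simp at h'
    have := mul_lt_mul e1 e2 e3 (Real.rpow_nonneg (hw'.le.trans hlt.le) _)
    linarith
  have i1 := hw.add hα hα' hβ
  have i2 := hw.add hα' hβ' hβ
  have n1 := hw.nonneg hα h1
  have n2 := hw.nonneg hβ' h3
  constructor
  · by_contra hne
    linarith [hw.pos hα (lt_of_le_of_ne h1 hne)]
  · by_contra hne
    linarith [hw.pos hβ' (lt_of_le_of_ne h3 hne)]

namespace EquilibriumPair

/-- Balance turns disorder into nesting. If `α' < α`, the left half at `t` has more mass than the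
left half at `s`; as `t ≥ s`, the right end must satisfy `β' > β`. The case `β' < β` is symmetric.
`eq_of_nested` excludes both. The case `s = t` is uniqueness; in general this is the monotonicity of
`a` and `b` on which all measurability and support arguments below rely. -/
theorem le_and_le (hq : 0 < q) (hp : 0 < p) (hw : PosLocDensity w) (hu : LocDensity u)
    {s t α β α' β' : ℝ} (hst : s ≤ t) (h : EquilibriumPair q p w u s α β)
    (h' : EquilibriumPair q p w u t α' β') : α ≤ α' ∧ β ≤ β' := by
  obtain ⟨a1, a2, a3, a4, a5⟩ := h
  obtain ⟨b1, b2, b3, b4, b5⟩ := h'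
  have hs := a1.trans a2
  have ht := b1.trans b2
  have hβ := hs.trans a3
  have hβ' := ht.trans b3
  have i1 := hw.add b1 a1 hs
  have i2 := hw.add b1 hs ht
  have i3 := hw.add hs ht hβ
  have i4 := hw.add ht hβ hβ'
  have i5 := hw.nonneg hs hst
  have key1 : α' < α → β < β' := by
    intro hlt
    by_contra! hle
    have := hw.pos b1 hlt
    have := hw.nonneg hβ' hle
    rw [intervalIntegral.integral_symm] at this
    linarith
  have key2 : β' < β → α < α' := by
    intro hlt
    by_contra! hle
    have := hw.pos hβ' hlt
    have := hw.nonneg b1 hle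
    have := intervalIntegral.integral_symm (μ := volume) (f := w) β' β
    linarith
  constructor
  · by_contra! hlt
    have := (eq_of_nested hq hp hw hu b1 hlt.le (a2.trans a3) (key1 hlt).le b5 a5).1
    linarith
  · by_contra! hlt
    have := (eq_of_nested hq hp hw hu a1 (key2 hlt).le (b2.trans b3) hlt.le a5 b5).1
    linarith [key2 hlt]

theorem unique (hq : 0 < q) (hp : 0 < p) (hw : PosLocDensity w) (hu : LocDensity u)
    {t α β α' β' : ℝ} (h : EquilibriumPair q p w u t α β)
    (h' : EquilibriumPair q p w u t α' β') : α = α' ∧ β = β' := by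
  have h1 := le_and_le hq hp hw hu le_rfl h h'
  have h2 := le_and_le hq hp hw hu le_rfl h' h
  exact ⟨le_antisymm h1.1 h2.1, le_antisymm h1.2 h2.2⟩

end EquilibriumPair

/-- Applied to the primitive of `w`, this allows endpoints to be parametrised continuously by mass.
-/
theorem exists_continuousOn_leftInverse {F : ℝ → ℝ} (hF : ContinuousOn F (Ioi 0))
    (hm : StrictMonoOn F (Ioi 0)) :
    ∃ R : ℝ → ℝ, ContinuousOn R (F '' Ioi 0) ∧ ∀ x, 0 < x → R (F x) = x := by
  have hR : ∀ x, 0 < x → Function.invFunOn F (Ioi 0) (F x) = x := fun x hx =>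
    hm.injOn.leftInvOn_invFunOn hx
  refine ⟨Function.invFunOn F (Ioi 0), ?_, hR⟩
  rintro _ ⟨x, hx : 0 < x, rfl⟩
  refine ContinuousAt.continuousWithinAt ?_
  refine StrictMonoOn.continuousAt_of_image_mem_nhds (s := F '' Ioi 0) ?_ ?_ ?_
  · rintro _ ⟨y, hy, rfl⟩ _ ⟨z, hz, rfl⟩ hyz
    rw [hR y hy, hR z hz]
    exact (hm.lt_iff_lt hy hz).1 hyz
  · have h1 : F (x / 2) < F x := hm (half_pos hx) hx (half_lt_self hx)
    have h2 : F x < F (2 * x) := hm hx (by simpa using hx) (by linarith)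
    refine mem_of_superset (Icc_mem_nhds h1 h2) ?_
    refine (intermediate_value_Icc (by linarith) (hF.mono ?_)).trans (image_mono ?_) <;>
    · intro y hy
      exact (half_pos hx).trans_le hy.1
  · rw [hR x hx]
    refine mem_of_superset (Ioi_mem_nhds hx) fun y hy => ⟨F y, ⟨y, hy, rfl⟩, hR y hy⟩

/-- If some balanced pair around `t` has product at least one, there is an equilibrium pair. -/
theorem exists_equilibriumPair_of_le (hq : 0 < q) (hp : 0 < p) (hw : PosLocDensity w)
    (hu : LocDensity u) {t α₁ β₁ : ℝ} (hα : 0 < α₁) (hαt : α₁ < t) (htβ : t < β₁)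
    (hbal : ∫ x in α₁..t, w x = ∫ x in t..β₁, w x)
    (hge : 1 ≤ (∫ x in α₁..β₁, w x) ^ (1 / q) * (∫ x in α₁..β₁, u x) ^ (1 / p)) :
    ∃ α β, EquilibriumPair q p w u t α β := by
  have ht := hα.trans hαt
  have hβ := ht.trans htβ
  set F : ℝ → ℝ := fun x => ∫ y in t..x, w y with hF
  obtain ⟨R, hRc, hR⟩ := exists_continuousOn_leftInverse (hw.continuousOn ht) (hw.strictMonoOn ht)
  set T := F β₁ with hT
  have hFα : F α₁ = -T := by
    change ∫ x in t..α₁, w x = -∫ x in t..β₁, w x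
    rw [intervalIntegral.integral_symm, hbal]
  have hFt : F t = 0 := by simp [hF]
  have hT0 : 0 < T := hw.pos ht htβ
  have hsub : Icc (-T) T ⊆ F '' Ioi 0 := by
    rw [← hFα, hT]
    refine (intermediate_value_Icc (by linarith) ((hw.continuousOn ht).mono ?_)).trans
      (image_mono ?_) <;>
    · intro y hy
      exact hα.trans_le hy.1
  have hmemR : ∀ z ∈ Icc (-T) T, 0 < R z ∧ F (R z) = z := by
    intro z hz
    obtain ⟨x, hx, rfl⟩ := hsub hz
    rw [hR x hx]
    exact ⟨hx, rfl⟩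
  have hlt : ∀ h ∈ Ioc 0 T, R (-h) < t ∧ t < R h := by
    intro h hh
    obtain ⟨p1, e1⟩ := hmemR (-h) ⟨by linarith [hh.2], by linarith [hh.1]⟩
    obtain ⟨p2, e2⟩ := hmemR h ⟨by linarith [hh.1], hh.2⟩
    constructor
    · refine ((hw.strictMonoOn ht).lt_iff_lt p1 ht).1 ?_
      change F (R (-h)) < F t
      rw [e1, hFt]
      linarith [hh.1]
    · refine ((hw.strictMonoOn ht).lt_iff_lt ht p2).1 ?_
      change F t < F (R h)
      rw [e2, hFt]
      exact hh.1
  -- The product over the balanced interval `(R (-h), R h)`, whose halves both have `w`-mass `h`. It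
  -- vanishes at `h = 0` and is at least one at `h = T`.
  let Ψ : ℝ → ℝ := fun h => (2 * h) ^ (1 / q) *
    ((∫ y in t..(R h), u y) - ∫ y in t..(R (-h)), u y) ^ (1 / p)
  have hΨ : ContinuousOn Ψ (Icc 0 T) := by
    have c1 : ContinuousOn (fun h => R h) (Icc 0 T) :=
      hRc.mono (fun z hz => hsub ⟨by linarith [hz.1], hz.2⟩)
    have c2 : ContinuousOn (fun h => R (-h)) (Icc 0 T) :=
      hRc.comp continuousOn_neg (fun z hz => hsub ⟨by linarith [hz.2], by linarith [hz.1]⟩)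
    refine ContinuousOn.mul ?_ ?_
    · exact (continuousOn_const.mul continuousOn_id).rpow_const
        fun x _ => Or.inr (one_div_pos.2 hq).le
    · refine ContinuousOn.rpow_const ?_ fun x _ => Or.inr (one_div_pos.2 hp).le
      refine ContinuousOn.sub ?_ ?_
      · exact (hu.continuousOn ht).comp c1 fun z hz => (hmemR z ⟨by linarith [hz.1], hz.2⟩).1
      · exact (hu.continuousOn ht).comp c2
          fun z hz => (hmemR (-z) ⟨by linarith [hz.2], by linarith [hz.1]⟩).1
  have hprod : ∀ α β, 0 < α → 0 < β → (∫ y in t..β, u y) - ∫ y in t..α, u y = ∫ y in α..β, u y := by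
    intro α β h1 h2
    have := hu.add ht h1 h2
    linarith
  have hΨ0 : Ψ 0 ≤ 1 := by
    simp [Ψ, Real.zero_rpow (inv_pos.2 hq).ne']
  have hΨT : 1 ≤ Ψ T := by
    have e1 : R T = β₁ := hR β₁ hβ
    have e2 : R (-T) = α₁ := by rw [← hFα]; exact hR α₁ hα
    simp only [Ψ]
    rw [e1, e2, hprod _ _ hα hβ]
    refine hge.trans_eq ?_
    congr 2
    rw [← hw.add hα ht hβ, hbal]
    change T + T = _
    ring
  obtain ⟨h, hh, hh1⟩ := intermediate_value_Icc hT0.le hΨ ⟨hΨ0, hΨT⟩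
  have hh0 : 0 < h := by
    refine hh.1.lt_of_ne fun h0 => ?_
    subst h0
    simp [Ψ, Real.zero_rpow (inv_pos.2 hq).ne'] at hh1
  obtain ⟨p1, e1⟩ := hmemR (-h) ⟨by linarith [hh.2], by linarith⟩
  obtain ⟨p2, e2⟩ := hmemR h ⟨by linarith, hh.2⟩
  have hl := hlt h ⟨hh0, hh.2⟩
  have e3 : ∫ x in R (-h)..t, w x = h := by
    rw [intervalIntegral.integral_symm]
    change -F (R (-h)) = h
    rw [e1]; ring
  have e4 : ∫ x in t..R h, w x = h := e2
  refine ⟨R (-h), R h, p1, hl.1, hl.2, e3.trans e4.symm, ?_⟩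
  refine Eq.trans ?_ hh1
  simp only [Ψ]
  rw [hprod _ _ p1 p2, ← hw.add p1 ht p2, e3, e4, two_mul]

end

/-! ### Existence of equilibrium pairs from infinite mass at both ends. -/

section

variable {w u : ℝ → ℝ} {q p : ℝ}

theorem PosLocDensity.exists_left (hw : PosLocDensity w) {a t z : ℝ} (ha : 0 < a) (hat : a < t)
    (hz : 0 < z) (hzt : z ≤ ∫ x in a..t, w x) : ∃ α, a ≤ α ∧ α < t ∧ ∫ x in α..t, w x = z := by
  have ht := ha.trans hat
  have hc : ContinuousOn (fun x => -∫ y in t..x, w y) (Icc a t) :=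
    ((hw.continuousOn ht).mono fun y hy => ha.trans_le hy.1).neg
  obtain ⟨α, hα, h⟩ := intermediate_value_Icc' hat.le hc (show z ∈ _ from by
    simp only [intervalIntegral.integral_same, neg_zero, ← intervalIntegral.integral_symm]
    exact ⟨hz.le, hzt⟩)
  simp only [← intervalIntegral.integral_symm] at h
  refine ⟨α, hα.1, hα.2.lt_of_ne fun h0 => ?_, h⟩
  rw [h0, intervalIntegral.integral_same] at h
  exact hz.ne h

theorem PosLocDensity.exists_right (hw : PosLocDensity w) {b t z : ℝ} (ht : 0 < t) (htb : t < b)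
    (hz : 0 < z) (hzt : z ≤ ∫ x in t..b, w x) : ∃ β, β ≤ b ∧ t < β ∧ ∫ x in t..β, w x = z := by
  have hc : ContinuousOn (fun x => ∫ y in t..x, w y) (Icc t b) :=
    ((hw.continuousOn ht).mono fun y hy => ht.trans_le hy.1)
  obtain ⟨β, hβ, h⟩ := intermediate_value_Icc htb.le hc (show z ∈ _ from by
    simp only [intervalIntegral.integral_same]
    exact ⟨hz.le, hzt⟩)
  refine ⟨β, hβ.2, hβ.1.lt_of_ne fun h0 => ?_, h⟩
  simp only [← h0, intervalIntegral.integral_same] at h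
  exact hz.ne h

/-- The product is monotone in both masses, so it suffices to dominate a pair of masses `A`, `B`
whose product is one. -/
theorem exists_equilibriumPair_of_bounds (hq : 0 < q) (hp : 0 < p) (hw : PosLocDensity w)
    (hu : LocDensity u) {t α β A B : ℝ} (hα : 0 < α) (hαt : α < t) (htβ : t < β)
    (hbal : ∫ x in α..t, w x = ∫ x in t..β, w x) (hA : 0 ≤ A) (hB : 0 ≤ B)
    (hAB : A ^ (1 / q) * B ^ (1 / p) = 1) (hAw : A ≤ ∫ x in α..β, w x)
    (hBu : B ≤ ∫ x in α..β, u x) : ∃ α β, EquilibriumPair q p w u t α β := by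
  refine exists_equilibriumPair_of_le hq hp hw hu hα hαt htβ hbal ?_
  refine hAB.symm.le.trans ?_
  exact mul_le_mul (Real.rpow_le_rpow hA hAw (one_div_pos.2 hq).le)
    (Real.rpow_le_rpow hB hBu (one_div_pos.2 hp).le) (Real.rpow_nonneg hB _)
    (Real.rpow_nonneg (hA.trans hAw) _)

theorem exists_rpow_mul_rpow_eq_one {A r s : ℝ} (hA : 0 < A) (hs : 0 < s) :
    ∃ B : ℝ, 0 ≤ B ∧ A ^ (1 / r) * B ^ (1 / s) = 1 := by
  have h := Real.rpow_pos_of_pos hA (1 / r)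
  refine ⟨((A ^ (1 / r))⁻¹) ^ s, by positivity, ?_⟩
  rw [← Real.rpow_mul (by positivity), mul_one_div_cancel hs.ne', Real.rpow_one,
    mul_inv_cancel₀ h.ne']

theorem exists_equilibriumPair_of_unbounded (hq : 0 < q) (hp : 0 < p) (hw : PosLocDensity w)
    (hu : LocDensity u) {t α₂ β₂ : ℝ} (hα₂ : 0 < α₂) (hα₂t : α₂ < t) (htβ₂ : t < β₂)
    (hpos : 0 < ∫ x in α₂..β₂, u x)
    (hL : ∀ M, ∃ α, 0 < α ∧ α < t ∧ M ≤ ∫ x in α..t, w x)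
    (hR : ∀ M, ∃ β, t < β ∧ M ≤ ∫ x in t..β, w x) : ∃ α β, EquilibriumPair q p w u t α β := by
  have ht := hα₂.trans hα₂t
  obtain ⟨A, hA, hAB⟩ := exists_rpow_mul_rpow_eq_one (r := p) hpos hq
  -- With half-mass `T` the balanced interval covers `[α₂, β₂]`, hence has at least its `u`-mass,
  -- and has `w`-mass at least `A`.
  set T := max A (max (∫ x in α₂..t, w x) (∫ x in t..β₂, w x)) with hT
  have hT1 : A ≤ T := le_max_left _ _
  have hT2 : ∫ x in α₂..t, w x ≤ T := (le_max_left _ _).trans (le_max_right _ _)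
  have hT3 : ∫ x in t..β₂, w x ≤ T := (le_max_right _ _).trans (le_max_right _ _)
  have hT0 : 0 < T := (hw.pos hα₂ hα₂t).trans_le hT2
  obtain ⟨a, ha, hat, haT⟩ := hL T
  obtain ⟨b, htb, hbT⟩ := hR T
  obtain ⟨α, hα, hαt, hαT⟩ := hw.exists_left ha hat hT0 haT
  obtain ⟨β, hβ, htβ, hβT⟩ := hw.exists_right ht htb hT0 hbT
  have hα0 := ha.trans_le hα
  have hαα : α ≤ α₂ := by
    by_contra! hlt
    have := hw.add hα₂ hα0 ht
    linarith [hw.pos hα₂ hlt]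
  have hββ : β₂ ≤ β := by
    by_contra! hlt
    have := hw.add ht (ht.trans htβ) (ht.trans htβ₂)
    linarith [hw.pos (ht.trans htβ) hlt]
  refine exists_equilibriumPair_of_bounds hq hp hw hu hα0 hαt htβ (hαT.trans hβT.symm) hA hpos.le
    ((mul_comm _ _).trans hAB) ?_ (hu.mono hα0 hαα (hα₂t.trans htβ₂).le hββ)
  have := hw.add hα0 ht (ht.trans htβ)
  linarith

/-- Existence of equilibrium pairs, if at either end one of the two densities has unbounded
integrals. -/
theorem exists_equilibriumPair (hq : 0 < q) (hp : 0 < p) (hw : PosLocDensity w)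
    (hu : LocDensity u) {t α₂ β₂ : ℝ} (hα₂ : 0 < α₂) (hα₂t : α₂ < t) (htβ₂ : t < β₂)
    (hpos : 0 < ∫ x in α₂..β₂, u x)
    (hL : (∀ M, ∃ α, 0 < α ∧ α < t ∧ M ≤ ∫ x in α..t, w x) ∨
      ∀ M, ∃ α, 0 < α ∧ α < t ∧ M ≤ ∫ x in α..t, u x)
    (hR : (∀ M, ∃ β, t < β ∧ M ≤ ∫ x in t..β, w x) ∨ ∀ M, ∃ β, t < β ∧ M ≤ ∫ x in t..β, u x) :
    ∃ α β, EquilibriumPair q p w u t α β := by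
  have ht := hα₂.trans hα₂t
  -- Either every left mass can be matched on the right, so that the left end is free to move
  -- towards `0`, or the right masses stay below some fixed left mass, so that the right end is free
  -- to move towards `∞`.
  by_cases hI : ∀ α, 0 < α → α < t → ∃ β, t < β ∧ ∫ x in α..t, w x = ∫ x in t..β, w x
  · rcases hL with hL | hL
    · refine exists_equilibriumPair_of_unbounded hq hp hw hu hα₂ hα₂t htβ₂ hpos hL fun M => ?_
      obtain ⟨α, h1, h2, h3⟩ := hL M
      obtain ⟨β, h4, h5⟩ := hI α h1 h2
      exact ⟨β, h4, h3.trans_eq h5⟩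
    -- The `w`-mass of `[t/2, t]` is kept as a lower bound, and the left end is moved until the
    -- `u`-mass reaches the `B` that completes it to product one.
    · have hA := hw.pos (half_pos ht) (half_lt_self ht)
      obtain ⟨B, hB, hAB⟩ := exists_rpow_mul_rpow_eq_one (r := q) hA hp
      obtain ⟨α, h1, h2, h3⟩ := hL B
      have hα : 0 < min α (t / 2) := lt_min h1 (half_pos ht)
      obtain ⟨β, h4, h5⟩ := hI (min α (t / 2)) hα ((min_le_left _ _).trans_lt h2)
      exact exists_equilibriumPair_of_bounds hq hp hw hu hα ((min_le_left _ _).trans_lt h2) h4 h5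
        hA.le hB hAB (hw.mono hα (min_le_right _ _) (half_le_self ht.le) h4.le)
        (h3.trans (hu.mono hα (min_le_left _ _) h2.le h4.le))
  · push Not at hI
    obtain ⟨α₀, hα₀, hα₀t, hne⟩ := hI
    have hlt : ∀ β, t < β → ∫ x in t..β, w x < ∫ x in α₀..t, w x := by
      intro β hβ
      by_contra! hle
      obtain ⟨β', -, h1, h2⟩ := hw.exists_right ht hβ (hw.pos hα₀ hα₀t) hle
      exact hne β' h1 h2.symm
    -- Right `w`-masses are bounded in this case, so only `u` can be unbounded on the right.
    rcases hR with hR | hR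
    · obtain ⟨β, h1, h2⟩ := hR (∫ x in α₀..t, w x)
      exact absurd (hlt β h1) (not_lt.2 h2)
    · have hA := hw.pos ht (lt_add_one t)
      obtain ⟨B, hB, hAB⟩ := exists_rpow_mul_rpow_eq_one (r := q) hA hp
      obtain ⟨β, h1, h2⟩ := hR B
      have hβ : t < max β (t + 1) := h1.trans_le (le_max_left _ _)
      obtain ⟨α, h3, h4, h5⟩ := hw.exists_left hα₀ hα₀t (hw.pos ht hβ) (hlt _ hβ).le
      have hα := hα₀.trans_le h3
      exact exists_equilibriumPair_of_bounds hq hp hw hu hα h4 hβ h5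
        hA.le hB hAB (hw.mono hα h4.le (by linarith) (le_max_right _ _))
        (h2.trans (hu.mono hα h4.le h1.le (le_max_left _ _)))

/-! ### From the weights to their densities. -/

/-- `F` is a version of `|f|^r` on the half-line, for an `f` in `L^r_loc(0,∞)`. -/
structure IsRpowDensity (r : ℝ) (f F : ℝ → ℝ) : Prop where
  one_le : 1 ≤ r
  locLp : LpLoc r f
  ae_eq : F =ᵐ[halfLine] fun x => |f x| ^ r

namespace IsRpowDensity
variable {r : ℝ} {f F : ℝ → ℝ}

theorem ae_nonneg (h : IsRpowDensity r f F) : ∀ᵐ x ∂halfLine, 0 ≤ F x := by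
  filter_upwards [h.ae_eq] with x hx
  rw [hx]
  positivity

theorem toReal_ofReal (h : IsRpowDensity r f F) : (ENNReal.ofReal r).toReal = r :=
  ENNReal.toReal_ofReal (zero_le_one.trans h.one_le)

theorem ofReal_ne_zero (h : IsRpowDensity r f F) : ENNReal.ofReal r ≠ 0 :=
  (ENNReal.ofReal_pos.2 (zero_lt_one.trans_le h.one_le)).ne'

theorem aestronglyMeasurable (h : IsRpowDensity r f F) : AEStronglyMeasurable f halfLine := by
  have : Ioi (0 : ℝ) = ⋃ n : ℕ, Icc (1 / ((n : ℝ) + 1)) n := by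
    ext x
    simp only [mem_Ioi, mem_iUnion, mem_Icc]
    constructor
    · intro hx
      obtain ⟨n, hn⟩ := exists_nat_gt (max x (1 / x))
      refine ⟨n, ?_, ((le_max_left _ _).trans_lt hn).le⟩
      have := (le_max_right _ _).trans_lt hn
      rw [div_le_iff₀ (by positivity)]
      rw [div_lt_iff₀ hx] at this
      nlinarith
    · rintro ⟨n, h1, -⟩
      exact lt_of_lt_of_le (by positivity) h1
  unfold halfLine
  rw [this, aestronglyMeasurable_iUnion_iff]
  intro n
  refine (h.locLp _ isCompact_Icc fun x hx => ?_).1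
  exact lt_of_lt_of_le (by positivity) hx.1

theorem integrableOn_iff (h : IsRpowDensity r f F) {s : Set ℝ} (hs : s ⊆ Ioi 0) :
    IntegrableOn F s ↔ MemLp f (ENNReal.ofReal r) (volume.restrict s) := by
  have hm : AEStronglyMeasurable f (volume.restrict s) :=
    h.aestronglyMeasurable.mono_measure (Measure.restrict_mono hs le_rfl)
  rw [← integrable_norm_rpow_iff hm h.ofReal_ne_zero ENNReal.ofReal_ne_top, h.toReal_ofReal]
  exact integrable_congr (ae_mono (Measure.restrict_mono hs le_rfl) h.ae_eq)

theorem integrableOn_Icc (h : IsRpowDensity r f F) {s t : ℝ} (hs : 0 < s) :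
    IntegrableOn F (Icc s t) :=
  (h.integrableOn_iff fun _ hx => hs.trans_le hx.1).2
    (h.locLp _ isCompact_Icc fun _ hx => hs.trans_le hx.1)

theorem ae_restrict (h : IsRpowDensity r f F) {s : Set ℝ} (hs : s ⊆ Ioi 0) :
    ∀ᵐ x ∂volume.restrict s, 0 ≤ F x :=
  ae_mono (Measure.restrict_mono hs le_rfl) h.ae_nonneg

theorem locDensity (h : IsRpowDensity r f F) : LocDensity F where
  integrable {s t} hs ht := by
    rw [intervalIntegrable_iff']
    exact h.integrableOn_Icc (lt_min hs ht)
  nonneg {s t} hs hst :=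
    intervalIntegral.integral_nonneg_of_ae_restrict hst
      (h.ae_restrict fun _ hx => hs.trans_le hx.1)

theorem posLocDensity (h : IsRpowDensity r f F) (hf : ∀ᵐ x ∂halfLine, 0 < |f x|) :
    PosLocDensity F where
  toLocDensity := h.locDensity
  pos {s t} hs hst := by
    have hsub : Ioc s t ⊆ Ioi 0 := fun _ hx => hs.trans hx.1
    have hpos : ∀ᵐ x ∂volume.restrict (Ioc s t), 0 < F x := by
      refine ae_mono (Measure.restrict_mono hsub le_rfl) ?_
      filter_upwards [h.ae_eq, hf] with x h1 h2
      rw [h1]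
      positivity
    rw [intervalIntegral.integral_of_le hst.le, integral_pos_iff_support_of_nonneg_ae
      (hpos.mono fun x hx => hx.le) (h.locDensity.integrable hs (hs.trans hst)).1]
    have : Function.support F =ᵐ[volume.restrict (Ioc s t)] univ := by
      filter_upwards [hpos] with x hx
      exact propext ⟨fun _ => trivial, fun _ => hx.ne'⟩
    rw [measure_congr this]
    simp [hst]

/-- Bounded integrals of `F ≥ 0` would make `F` integrable on `(0, t]`; local integrability extends
this to `(0, c)`, contradicting the infinite norm. The splitting point `c` therefore plays no role.
-/
theorem unbounded_left (h : IsRpowDensity r f F) {c t : ℝ} (ht : 0 < t)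
    (htop : eLpNorm f (ENNReal.ofReal r) (volume.restrict (Ioo 0 c)) = ∞) (M : ℝ) :
    ∃ α, 0 < α ∧ α < t ∧ M ≤ ∫ x in α..t, F x := by
  by_contra! hM
  have hlim : Tendsto (fun n : ℕ => t / ((n : ℝ) + 2)) atTop (𝓝 0) :=
    tendsto_const_nhds.div_atTop
      (tendsto_atTop_add_const_right _ _ tendsto_natCast_atTop_atTop)
  have hI : IntegrableOn F (Ioc 0 t) := by
    refine integrableOn_Ioc_of_intervalIntegral_norm_bounded_left (l := atTop) (I := M)
      (a := fun n : ℕ => t / ((n : ℝ) + 2)) (fun n => ?_) hlim (Eventually.of_forall fun n => ?_)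
    · exact (h.integrableOn_Icc (by positivity)).mono_set Ioc_subset_Icc_self
    · have hn : t / ((n : ℝ) + 2) < t := by
        rw [div_lt_iff₀ (by positivity)]
        have : (0 : ℝ) ≤ n := n.cast_nonneg
        nlinarith
      have hn0 : 0 < t / ((n : ℝ) + 2) := by positivity
      refine le_trans (le_of_eq ?_) (hM _ hn0 hn).le
      rw [intervalIntegral.integral_of_le hn.le]
      refine integral_congr_ae ?_
      filter_upwards [h.ae_restrict (s := Ioc (t / ((n : ℝ) + 2)) t) fun x hx => hn0.trans hx.1]
        with x hx
      exact Real.norm_of_nonneg hx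
  have hI2 : IntegrableOn F (Ioo 0 c) := by
    refine (hI.union (h.integrableOn_Icc (t := c) ht)).mono_set fun x hx => ?_
    rcases le_total x t with h1 | h1
    · exact Or.inl ⟨hx.1, h1⟩
    · exact Or.inr ⟨h1, hx.2.le⟩
  exact ((h.integrableOn_iff fun x hx => hx.1).1 hI2).2.ne htop

theorem unbounded_right (h : IsRpowDensity r f F) {c t : ℝ} (hc : 0 < c) (ht : 0 < t)
    (htop : eLpNorm f (ENNReal.ofReal r) (volume.restrict (Ioi c)) = ∞) (M : ℝ) :
    ∃ β, t < β ∧ M ≤ ∫ x in t..β, F x := by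
  by_contra! hM
  have hlim : Tendsto (fun n : ℕ => t + ((n : ℝ) + 1)) atTop atTop :=
    tendsto_atTop_add_const_left _ _ (tendsto_atTop_add_const_right _ _ tendsto_natCast_atTop_atTop)
  have hI : IntegrableOn F (Ioi t) := by
    refine integrableOn_Ioi_of_intervalIntegral_norm_bounded (l := atTop) (I := M) t
      (b := fun n : ℕ => t + ((n : ℝ) + 1)) (fun n => ?_) hlim (Eventually.of_forall fun n => ?_)
    · exact (h.integrableOn_Icc ht).mono_set Ioc_subset_Icc_self
    · have hn : t < t + ((n : ℝ) + 1) := by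
        have : (0 : ℝ) ≤ n := n.cast_nonneg
        linarith
      refine le_trans (le_of_eq ?_) (hM _ hn).le
      rw [intervalIntegral.integral_of_le hn.le, intervalIntegral.integral_of_le hn.le]
      refine integral_congr_ae ?_
      filter_upwards [h.ae_restrict (s := Ioc t (t + ((n : ℝ) + 1))) fun x hx => ht.trans hx.1]
        with x hx
      exact Real.norm_of_nonneg hx
  have hI2 : IntegrableOn F (Ioi c) := by
    refine (hI.union (h.integrableOn_Icc (t := t) hc)).mono_set fun x hx => ?_
    rcases le_or_gt x t with h1 | h1
    · exact Or.inr ⟨le_of_lt hx, h1⟩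
    · exact Or.inl h1
  exact ((h.integrableOn_iff fun x hx => hc.trans hx).1 hI2).2.ne htop

theorem exists_integral_pos (h : IsRpowDensity r f F) (hf : ¬ f =ᵐ[halfLine] 0) {t : ℝ}
    (ht : 0 < t) : ∃ α β, 0 < α ∧ α < t ∧ t < β ∧ 0 < ∫ x in α..β, F x := by
  by_contra! hc
  apply hf
  have hz : ∀ n : ℕ, ∀ᵐ x, x ∈ Ioc (t / ((n : ℝ) + 2)) (t + ((n : ℝ) + 1)) → F x = 0 := by
    intro n
    have hn0 : (0 : ℝ) ≤ n := n.cast_nonneg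
    have h0 : 0 < t / ((n : ℝ) + 2) := by positivity
    have h1 : t / ((n : ℝ) + 2) < t := by
      rw [div_lt_iff₀ (by positivity)]
      nlinarith
    have h2 : t < t + ((n : ℝ) + 1) := by linarith
    have h3 := le_antisymm (hc _ _ h0 h1 h2) (h.locDensity.nonneg h0 (h1.trans h2).le)
    rw [intervalIntegral.integral_of_le (h1.trans h2).le, integral_eq_zero_iff_of_nonneg_ae
      (h.ae_restrict fun x hx => h0.trans hx.1)
      (h.locDensity.integrable h0 (ht.trans h2)).1] at h3
    exact (ae_restrict_iff' measurableSet_Ioc).1 h3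
  have hz' : ∀ᵐ x ∂halfLine, F x = 0 := by
    rw [ae_restrict_iff' measurableSet_Ioi]
    filter_upwards [ae_all_iff.2 hz] with x hx (hx0 : 0 < x)
    obtain ⟨n, hn⟩ := exists_nat_gt (max x (t / x))
    refine hx n ⟨?_, by linarith [(le_max_left _ _).trans_lt hn]⟩
    have := (le_max_right _ _).trans_lt hn
    rw [div_lt_iff₀ hx0] at this
    rw [div_lt_iff₀ (by positivity)]
    nlinarith
  filter_upwards [hz', h.ae_eq] with x h1 h2
  rw [h1] at h2
  have := (Real.rpow_eq_zero (abs_nonneg _) (zero_lt_one.trans_le h.one_le).ne').1 h2.symm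
  simpa using this

end IsRpowDensity

variable {v₀ v₁ : ℝ → ℝ}

theorem isRpowDensity_inv (hp : 1 < p) (hinv : InvLpLoc p.conjExponent v₁) :
    IsRpowDensity p.conjExponent (fun x => (v₁ x)⁻¹) (fun x => v₁ x ^ (-p.conjExponent)) where
  one_le := (Real.HolderConjugate.conjExponent hp).symm.lt.le
  locLp := hinv.2
  ae_eq := by
    filter_upwards [hinv.1] with x hx
    rw [abs_of_pos (inv_pos.2 hx), Real.rpow_neg hx.le, Real.inv_rpow hx.le]

theorem isRpowDensity_rpow (hp : 1 < p) (hv₀ : IsWeight p v₀) :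
    IsRpowDensity p v₀ (fun x => v₀ x ^ p) where
  one_le := hp.le
  locLp := hv₀.1
  ae_eq := by
    filter_upwards [hv₀.2.1] with x hx
    rw [abs_of_nonneg hx]

theorem posLocDensity_inv (hp : 1 < p) (hinv : InvLpLoc p.conjExponent v₁) :
    PosLocDensity (fun x => v₁ x ^ (-p.conjExponent)) :=
  (isRpowDensity_inv hp hinv).posLocDensity <| hinv.1.mono fun x hx => by positivity

theorem existsUnique_isEquilibriumPair (hp : 1 < p) (hv₀ : IsWeight p v₀)
    (hinv : InvLpLoc p.conjExponent v₁) (hends : BothEndsInfinite p v₀ v₁) {t : ℝ} (ht : 0 < t) :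
    ∃! z : ℝ × ℝ, IsEquilibriumPair p v₀ v₁ t z.1 z.2 := by
  have hq : 0 < p.conjExponent := (Real.HolderConjugate.conjExponent hp).symm.pos
  have hp0 : 0 < p := zero_lt_one.trans hp
  have h1 := isRpowDensity_inv hp hinv
  have h0 := isRpowDensity_rpow hp hv₀
  obtain ⟨c, hc, hl, hr⟩ := hends
  obtain ⟨α₂, β₂, hα, hαt, htβ, hpos⟩ := h0.exists_integral_pos hv₀.2.2 ht
  obtain ⟨α, β, h⟩ := exists_equilibriumPair hq hp0 (posLocDensity_inv hp hinv) h0.locDensity hα hαt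
    htβ hpos
    (by
      rcases ENNReal.mul_eq_top.1 hl with h | h
      · exact Or.inr (h0.unbounded_left ht h.2)
      · exact Or.inl (h1.unbounded_left ht h.1))
    (by
      rcases ENNReal.mul_eq_top.1 hr with h | h
      · exact Or.inr (h0.unbounded_right hc ht h.2)
      · exact Or.inl (h1.unbounded_right hc ht h.1))
  refine ⟨(α, β), h, fun z hz => ?_⟩
  have := EquilibriumPair.unique hq hp0 (posLocDensity_inv hp hinv) h0.locDensity hz h
  exact Prod.ext this.1 this.2

end

/-! ### Oscillating test functions: weakly null, but not small in `L¹`. -/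

section

/-- The Riemann–Lebesgue lemma for the cosine transform along the integers. -/
theorem tendsto_integral_mul_cos {h : ℝ → ℝ} (hh : Integrable h) :
    Tendsto (fun n : ℕ => ∫ x, h x * Real.cos (n * x)) atTop (𝓝 0) := by
  -- The Fourier character is `exp (2πi ·)`, so `cos (n x)` has frequency `n / (2π)`.
  have hlim : Tendsto (fun n : ℕ => (n : ℝ) / (2 * Real.pi)) atTop (cocompact ℝ) :=
    (tendsto_natCast_atTop_atTop.atTop_div_const Real.two_pi_pos).mono_right atTop_le_cocompact
  have h1 := (Real.tendsto_integral_exp_smul_cocompact (fun x => (h x : ℂ))).comp hlim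
  have h2 := (Complex.continuous_re.tendsto 0).comp h1
  refine h2.congr fun n => ?_
  simp only [Function.comp]
  have hi : Integrable (fun v : ℝ => Real.fourierChar (-(v * ((n : ℝ) / (2 * Real.pi)))) •
      (h v : ℂ)) := by
    have := (Real.fourierIntegral_convergent_iff (μ := volume) (f := fun x => (h x : ℂ))
      ((n : ℝ) / (2 * Real.pi))).2 hh.ofReal
    refine this.congr (Eventually.of_forall fun v => ?_)
    simp [mul_comm]
  refine (integral_re (𝕜 := ℂ) hi).symm.trans ?_
  refine integral_congr_ae (Eventually.of_forall fun v => ?_)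
  simp only [Circle.smul_def, Real.fourierChar_apply, smul_eq_mul]
  have e : (↑(2 * Real.pi * -(v * ((n : ℝ) / (2 * Real.pi)))) * Complex.I : ℂ)
      = ((-(n * v) : ℝ) : ℂ) * Complex.I := by
    congr 2
    field_simp
  rw [e, mul_comm]
  simp [Complex.exp_ofReal_mul_I_re, -Complex.ofReal_neg]

/-- The function `cos (n x)` on the set `E`, corrected by a constant to have mean value zero, and
extended by zero. -/
noncomputable def oscillation (E : Set ℝ) (n : ℕ) : ℝ → ℝ :=
  E.indicator fun x => Real.cos (n * x) - ⨍ y in E, Real.cos (n * y)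

section oscillation
variable {E : Set ℝ}

theorem measurable_oscillation (hE : MeasurableSet E) (n : ℕ) : Measurable (oscillation E n) := by
  refine Measurable.indicator ?_ hE
  fun_prop

theorem abs_average_cos_le (n : ℕ) : |⨍ y in E, Real.cos (n * y)| ≤ 1 := by
  rw [setAverage_eq, smul_eq_mul, abs_mul, abs_of_nonneg (by positivity)]
  by_cases hE : volume E = ∞
  -- Here `volume.real E = 0`, so the average is zero by convention.
  · simp [Measure.real, hE]
  have h1 : ‖∫ y in E, Real.cos (n * y)‖ ≤ 1 * volume.real E :=
    norm_setIntegral_le_of_norm_le_const (lt_top_iff_ne_top.2 hE)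
      fun x _ => Real.abs_cos_le_one _
  rw [one_mul, Real.norm_eq_abs] at h1
  calc _ ≤ (volume.real E)⁻¹ * volume.real E := by gcongr
    _ ≤ 1 := inv_mul_le_one

theorem abs_oscillation_le (n : ℕ) (x : ℝ) : |oscillation E n x| ≤ 2 := by
  unfold oscillation indicator
  split_ifs
  · refine (abs_sub _ _).trans ?_
    linarith [Real.abs_cos_le_one (n * x), abs_average_cos_le (E := E) n]
  · simp

theorem oscillation_eq_zero {n : ℕ} {x : ℝ} (hx : x ∉ E) : oscillation E n x = 0 :=
  indicator_of_notMem hx _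

theorem integrable_cos (hE' : volume E ≠ ∞) (a : ℝ) :
    IntegrableOn (fun x => Real.cos (a * x)) E := by
  refine (integrableOn_const (C := (1 : ℝ)) hE').mono' (by fun_prop) ?_
  exact Eventually.of_forall fun x => Real.abs_cos_le_one _

theorem integrable_oscillation (hE : MeasurableSet E) (hE' : volume E ≠ ∞) (n : ℕ) :
    Integrable (oscillation E n) := by
  rw [oscillation, integrable_indicator_iff hE]
  exact (integrable_cos hE' n).sub (integrableOn_const hE')

/-- The reason for subtracting the mean: it removes the boundary term at the right end in the
integration by parts. -/
theorem integral_oscillation (hE : MeasurableSet E) (hE' : volume E ≠ ∞) (hE0 : volume E ≠ 0)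
    (n : ℕ) : ∫ x, oscillation E n x = 0 := by
  rw [oscillation, integral_indicator hE, integral_sub (integrable_cos hE' n)
    (integrableOn_const hE'), setAverage_eq, setIntegral_const, smul_eq_mul, smul_eq_mul,
    ← mul_assoc, mul_inv_cancel₀ (show volume.real E ≠ 0 from (ENNReal.toReal_pos hE0 hE').ne'), one_mul,
    sub_self]

theorem tendsto_average_cos (hE : MeasurableSet E) (hE' : volume E ≠ ∞) :
    Tendsto (fun n : ℕ => ⨍ y in E, Real.cos (n * y)) atTop (𝓝 0) := by
  have h := tendsto_integral_mul_cos
    ((integrable_indicator_iff hE).2 (integrableOn_const (C := (1 : ℝ)) hE'))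
  have h2 := h.const_mul (volume.real E)⁻¹
  rw [mul_zero] at h2
  refine h2.congr fun n => ?_
  rw [setAverage_eq, smul_eq_mul, ← integral_indicator hE]
  congr 2
  ext x
  by_cases hx : x ∈ E <;> simp [hx]

/-- The oscillations converge weakly to zero. -/
theorem tendsto_integral_mul_oscillation (hE : MeasurableSet E) (hE' : volume E ≠ ∞) {h : ℝ → ℝ}
    (hh : IntegrableOn h E) :
    Tendsto (fun n : ℕ => ∫ x, h x * oscillation E n x) atTop (𝓝 0) := by
  have hi := (integrable_indicator_iff hE).2 hh
  have h1 := (tendsto_integral_mul_cos hi).sub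
    ((tendsto_average_cos hE hE').const_mul (∫ x, E.indicator h x))
  rw [mul_zero, sub_zero] at h1
  refine h1.congr fun n => ?_
  rw [← integral_mul_const, ← integral_sub _ (hi.mul_const _)]
  · congr 1
    ext x
    by_cases hx : x ∈ E <;> simp [hx, oscillation, mul_sub]
  · exact hi.mul_bdd (c := 1) (by fun_prop)
      (Eventually.of_forall fun x => Real.abs_cos_le_one _)

/-- `|cos| ≥ cos² = (1 + cos (2n x)) / 2`, whose integral over `E` tends to `|E| / 2`, while the
subtracted mean tends to zero. The constant `1/4` leaves room for both errors. -/
theorem eventually_le_integral_abs_oscillation (hE : MeasurableSet E) (hE' : volume E ≠ ∞)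
    (hE0 : volume E ≠ 0) :
    ∀ᶠ n in atTop, volume.real E / 4 ≤ ∫ x, |oscillation E n x| := by
  have hpos : 0 < volume.real E := ENNReal.toReal_pos hE0 hE'
  have h1 := (tendsto_integral_mul_cos ((integrable_indicator_iff hE).2
    (integrableOn_const (C := (1 : ℝ)) hE'))).comp (tendsto_id.const_mul_atTop' (two_pos (α := ℕ)))
  have h2 := (h1.div_const 2).sub ((tendsto_average_cos hE hE').abs.mul_const (volume.real E))
  rw [abs_zero, zero_div, zero_mul, sub_zero] at h2
  filter_upwards [h2.eventually (lt_mem_nhds (show -(volume.real E / 4) < 0 by linarith))] with n hn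
  simp only [Function.comp, id] at hn
  have e1 : ∫ x, E.indicator (fun _ => (1 : ℝ)) x * Real.cos (↑(2 * n) * x)
      = ∫ x in E, Real.cos (↑(2 * n) * x) := by
    rw [← integral_indicator hE]
    congr 1
    ext x
    by_cases hx : x ∈ E <;> simp [hx]
  rw [e1] at hn
  set k := ⨍ y in E, Real.cos (n * y) with hk
  have hi : IntegrableOn (fun x => (1 / 2 - |k|) + Real.cos (↑(2 * n) * x) / 2) E :=
    (integrableOn_const hE').add ((integrable_cos hE' _).div_const 2)
  have e2 : ∫ x in E, ((1 / 2 - |k|) + Real.cos (↑(2 * n) * x) / 2)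
      = (1 / 2 - |k|) * volume.real E + (∫ x in E, Real.cos (↑(2 * n) * x)) / 2 := by
    rw [integral_add (integrableOn_const (C := 1 / 2 - |k|) hE') ((integrable_cos hE' _).div_const 2),
      setIntegral_const, integral_div, smul_eq_mul, mul_comm]
  have e3 : ∫ x, |oscillation E n x| = ∫ x in E, |oscillation E n x| := by
    rw [setIntegral_eq_integral_of_forall_compl_eq_zero]
    intro x hx
    rw [oscillation_eq_zero hx, abs_zero]
  rw [e3]
  refine le_trans ?_ (setIntegral_mono_on hi
    (integrable_oscillation hE hE' n).abs.integrableOn hE fun x hx => ?_)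
  · rw [e2]
    linarith
  · rw [oscillation, indicator_of_mem hx, ← hk]
    have h3 := abs_sub_abs_le_abs_sub (Real.cos (n * x)) k
    have h4 : Real.cos (n * x) ^ 2 ≤ |Real.cos (n * x)| := by
      rw [← sq_abs]
      nlinarith [abs_nonneg (Real.cos (n * x)), Real.abs_cos_le_one (n * x)]
    have h5 : Real.cos (↑(2 * n) * x) = 2 * Real.cos (n * x) ^ 2 - 1 := by
      rw [← Real.cos_two_mul]
      push_cast
      ring_nf
    rw [h5]
    linarith

end oscillation

theorem exists_set_le_abs {f : ℝ → ℝ} (hf : AEMeasurable f halfLine)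
    (h0 : 0 < volume {x : ℝ | 0 < x ∧ f x ≠ 0}) :
    ∃ c d δ : ℝ, ∃ E : Set ℝ, 0 < c ∧ c < d ∧ 0 < δ ∧ MeasurableSet E ∧ E ⊆ Icc c d ∧
      volume E ≠ 0 ∧ ∀ᵐ x ∂volume.restrict E, δ ≤ |f x| := by
  set F := hf.mk f with hF
  have hFm : Measurable F := hf.measurable_mk
  -- If all these sets were null, `f` would vanish a.e. on the half-line. The upper end `n + 2`
  -- keeps the interval nondegenerate for `n = 0`.
  let S : ℕ → Set ℝ := fun n => Icc (1 / ((n : ℝ) + 1)) ((n : ℝ) + 2) ∩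
    {x | 1 / ((n : ℝ) + 1) ≤ |F x|}
  have hS : ∃ n, volume (S n) ≠ 0 := by
    by_contra! hS
    refine h0.ne' ?_
    have h1 : ∀ᵐ x, 0 < x → f x = F x := (ae_restrict_iff' measurableSet_Ioi).1 hf.ae_eq_mk
    have h2 : ∀ᵐ x, ∀ n, x ∉ S n := by
      rw [ae_all_iff]
      exact fun n => measure_eq_zero_iff_ae_notMem.1 (hS n)
    rw [measure_eq_zero_iff_ae_notMem]
    filter_upwards [h1, h2] with x hx1 hx2 hx
    have hFx : 0 < |F x| := by
      rw [← hx1 hx.1]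
      exact abs_pos.2 hx.2
    have hx0 := hx.1
    obtain ⟨n, hn⟩ := exists_nat_gt (max x (max (1 / x) (1 / |F x|)))
    have n1 := (le_max_left _ _).trans_lt hn
    have n2 := ((le_max_left _ _).trans (le_max_right _ _)).trans_lt hn
    have n3 := ((le_max_right _ _).trans (le_max_right _ _)).trans_lt hn
    rw [div_lt_iff₀ (by assumption)] at n2 n3
    refine hx2 n ⟨⟨?_, by linarith⟩, ?_⟩
    · rw [div_le_iff₀ (by positivity)]
      nlinarith
    · change 1 / ((n : ℝ) + 1) ≤ |F x|
      rw [div_le_iff₀ (by positivity)]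
      nlinarith
  obtain ⟨n, hn⟩ := hS
  have hle : (1 : ℝ) / (n + 1) ≤ 1 := by
    rw [div_le_one (by positivity)]
    have : (0 : ℝ) ≤ n := n.cast_nonneg
    linarith
  have hm : MeasurableSet (S n) :=
    measurableSet_Icc.inter (measurableSet_le measurable_const hFm.abs)
  refine ⟨1 / ((n : ℝ) + 1), n + 2, 1 / ((n : ℝ) + 1), S n, by positivity, ?_, by positivity,
    hm, inter_subset_left, hn, ?_⟩
  · have : (0 : ℝ) ≤ n := n.cast_nonneg
    linarith
  · have hsub : S n ⊆ Ioi 0 := fun x hx => lt_of_lt_of_le (by positivity) hx.1.1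
    filter_upwards [ae_mono (Measure.restrict_mono hsub le_rfl) hf.ae_eq_mk,
      ae_restrict_mem hm] with x h1 h2
    rw [h1]
    exact h2.2

/-- A function that does not vanish a.e. is not small in mean against the oscillations on a
suitable bounded set. -/
theorem eventually_le_lintegral_mul_oscillation {f : ℝ → ℝ} {E : Set ℝ} {δ : ℝ} (hδ : 0 < δ)
    (hE : MeasurableSet E) (hE' : volume E ≠ ∞) (hE0 : volume E ≠ 0) (hsub : E ⊆ Ioi 0)
    (hf : ∀ᵐ x ∂volume.restrict E, δ ≤ |f x|) :
    ∃ κ : ℝ≥0∞, κ ≠ 0 ∧ ∀ᶠ n in atTop, κ ≤ ∫⁻ x, ‖f x * oscillation E n x‖ₑ ∂halfLine := by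
  have hpos : 0 < volume.real E := ENNReal.toReal_pos hE0 hE'
  refine ⟨ENNReal.ofReal δ * ENNReal.ofReal (volume.real E / 4), ?_, ?_⟩
  · simp only [ne_eq, mul_eq_zero, ENNReal.ofReal_eq_zero, not_or, not_le]
    exact ⟨hδ, by positivity⟩
  filter_upwards [eventually_le_integral_abs_oscillation hE hE' hE0] with n hn
  have hi := integrable_oscillation hE hE' n
  calc ENNReal.ofReal δ * ENNReal.ofReal (volume.real E / 4)
      ≤ ENNReal.ofReal δ * ∫⁻ x, ‖oscillation E n x‖ₑ := by
        gcongr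
        rw [← ofReal_integral_norm_eq_lintegral_enorm hi]
        exact ENNReal.ofReal_le_ofReal hn
    _ = ENNReal.ofReal δ * ∫⁻ x in E, ‖oscillation E n x‖ₑ := by
        rw [← lintegral_indicator hE]
        congr 2
        ext x
        by_cases hx : x ∈ E <;> simp [hx, oscillation_eq_zero]
    _ = ∫⁻ x in E, ENNReal.ofReal δ * ‖oscillation E n x‖ₑ :=
        (lintegral_const_mul _ (measurable_oscillation hE n).enorm).symm
    _ ≤ ∫⁻ x in E, ‖f x * oscillation E n x‖ₑ := by
        refine lintegral_mono_ae (hf.mono fun x hx => ?_)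
        rw [enorm_mul]
        gcongr
        rw [← ofReal_norm]
        exact ENNReal.ofReal_le_ofReal hx
    _ ≤ _ := lintegral_mono_set hsub

/-- If the norms of elements that are not small against `f` tend to zero, the strong functional is
infinite at `f`. -/
theorem strongFunctional_eq_top {X : Set (ℝ → ℝ)} {N : (ℝ → ℝ) → ℝ≥0∞} {f : ℝ → ℝ}
    {g : ℕ → ℝ → ℝ} {κ : ℝ≥0∞} (hκ : κ ≠ 0) (hg : ∀ᶠ n in atTop, g n ∈ X)
    (hle : ∀ᶠ n in atTop, κ ≤ ∫⁻ x, ‖f x * g n x‖ₑ ∂halfLine)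
    (hN : Tendsto (fun n => N (g n)) atTop (𝓝 0)) : strongFunctional X N f = ∞ := by
  have hlim : Tendsto (fun n => κ / N (g n)) atTop (𝓝 (κ / 0)) :=
    ENNReal.Tendsto.const_div hN (Or.inl ENNReal.zero_ne_top)
  -- This needs `κ ≠ 0`, since `0 / 0 = 0` in `ℝ≥0∞`. The same lower bound `κ` shows below that `g
  -- n` is not a.e. zero.
  rw [ENNReal.div_zero hκ] at hlim
  refine top_le_iff.1 (le_of_tendsto hlim ?_)
  filter_upwards [hle, hg] with n hn hgn
  have h0 : ¬ g n =ᵐ[halfLine] 0 := by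
    intro h0
    refine hκ (le_antisymm (hn.trans_eq ?_) zero_le)
    rw [lintegral_congr_ae (g := fun _ => 0) ?_, lintegral_zero]
    filter_upwards [h0] with x hx
    simp [hx]
  refine le_trans ?_ (le_iSup₂_of_le (g n) ⟨hgn, h0⟩ le_rfl)
  gcongr
  refine hn.trans_eq (lintegral_congr fun x => ?_)
  rw [mul_comm]

/-- Dominated convergence for weighted `L^r` norms. -/
theorem tendsto_weighted_lintegral_rpow {μ : Measure ℝ} {φ : ℝ → ℝ≥0∞} {k : ℕ → ℝ → ℝ}
    {C r : ℝ} (hr : 0 < r) (hφ : AEMeasurable φ μ) (hφ' : ∫⁻ x, φ x ∂μ ≠ ∞)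
    (hk : ∀ n, AEMeasurable (k n) μ) (hC : ∀ n, ∀ᵐ x ∂μ, |k n x| ≤ C)
    (hlim : ∀ᵐ x ∂μ, Tendsto (fun n => k n x) atTop (𝓝 0)) :
    Tendsto (fun n => (∫⁻ x, φ x * ENNReal.ofReal (|k n x| ^ r) ∂μ) ^ (1 / r)) atTop (𝓝 0) := by
  have h := tendsto_lintegral_of_dominated_convergence' (μ := μ) (f := fun _ => 0)
    (F := fun n x => φ x * ENNReal.ofReal (|k n x| ^ r))
    (fun x => φ x * ENNReal.ofReal (C ^ r))
    (fun n => hφ.mul ((hk n).abs.pow_const r).ennreal_ofReal)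
    (fun n => (hC n).mono fun x hx => by
      dsimp only
      gcongr)
    (by
      rw [lintegral_mul_const'' _ hφ]
      exact ENNReal.mul_ne_top hφ' ENNReal.ofReal_ne_top)
    (by
      have hfin := ae_lt_top' hφ hφ'
      filter_upwards [hlim, hfin] with x hx hx'
      have h1 : Tendsto (fun n => |k n x| ^ r) atTop (𝓝 (|0| ^ r)) :=
        (hx.abs).rpow_const (Or.inr hr.le)
      rw [abs_zero, Real.zero_rpow hr.ne'] at h1
      have h2 := ENNReal.Tendsto.const_mul (a := φ x) (ENNReal.tendsto_ofReal h1)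
        (Or.inr hx'.ne)
      simpa using h2)
  have h3 := h.ennrpow_const (1 / r)
  simpa [ENNReal.zero_rpow_of_pos (inv_pos.2 hr)] using h3

end

/-! ### The weak associate norm of the oscillations over the Sobolev space. -/

section

variable {p : ℝ} {v₀ v₁ f : ℝ → ℝ} {E : Set ℝ} {c d : ℝ}

theorem volume_ne_top_of_subset_Icc (hsub : E ⊆ Icc c d) : volume E ≠ ∞ :=
  ne_top_of_le_ne_top (by simp) (measure_mono hsub)

/-- Integration by parts on `[c, d]`. The primitive of the oscillation vanishes at `c` by its choice
and at `d` by the zero mean, so nothing is needed of `f` at the endpoints. -/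
theorem integral_mul_oscillation_eq_neg (hc : 0 < c) (hcd : c < d) (hE : MeasurableSet E)
    (hsub : E ⊆ Icc c d) (hE0 : volume E ≠ 0) (hf : AbsolutelyContinuousOnInterval f c d) (n : ℕ) :
    ∫ x, f x * oscillation E n x ∂halfLine =
      -∫ x in c..d, deriv f x * ∫ y in c..x, oscillation E n y := by
  have hE' := volume_ne_top_of_subset_Icc hsub
  have hi := integrable_oscillation hE hE' n
  have hz : ∀ x ∉ Icc c d, oscillation E n x = 0 := fun x hx =>
    oscillation_eq_zero fun h => hx (hsub h)
  have hint : ∀ (h : ℝ → ℝ) (s : Set ℝ), MeasurableSet s → Icc c d ⊆ s →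
      ∫ x in s, h x * oscillation E n x = ∫ x in c..d, h x * oscillation E n x := by
    intro h s hs hcs
    rw [setIntegral_eq_of_subset_of_forall_sdiff_eq_zero hs hcs fun x hx => by
      rw [hz x hx.2, mul_zero], integral_Icc_eq_integral_Ioc,
      ← intervalIntegral.integral_of_le hcd.le]
  have h0 : ∫ y in c..d, oscillation E n y = 0 := by
    have := hint (fun _ => 1) univ MeasurableSet.univ (subset_univ _)
    simp only [one_mul, setIntegral_univ] at this
    rw [← this, integral_oscillation hE hE' hE0]
  rw [hint f (Ioi 0) measurableSet_Ioi fun x hx => hc.trans_le hx.1]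
  have hii : IntervalIntegrable (oscillation E n) volume c d := hi.intervalIntegrable
  have hG := hii.absolutelyContinuousOnInterval_intervalIntegral left_mem_uIcc
  have hparts := hf.integral_mul_deriv_eq_deriv_mul hG
  rw [h0, intervalIntegral.integral_same, mul_zero, mul_zero, sub_zero, zero_sub] at hparts
  rw [← hparts]
  refine intervalIntegral.integral_congr_ae ?_
  filter_upwards [hii.ae_hasDerivAt_integral] with x hx hx'
  rw [(hx (uIoc_subset_uIcc hx') c left_mem_uIcc).deriv]

/-- The weighted norm of the primitives of the oscillations. -/
noncomputable def primitiveNorm (p : ℝ) (v₁ : ℝ → ℝ) (E : Set ℝ) (c d : ℝ) (n : ℕ) : ℝ≥0∞ :=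
  (∫⁻ x in Ioc c d, ENNReal.ofReal (v₁ x ^ (-p.conjExponent)) *
    ENNReal.ofReal (|∫ y in c..x, oscillation E n y| ^ p.conjExponent)) ^ (1 / p.conjExponent)

theorem continuous_primitive_oscillation (hE : MeasurableSet E) (hE' : volume E ≠ ∞) (n : ℕ) :
    Continuous fun x => ∫ y in c..x, oscillation E n y :=
  intervalIntegral.continuous_primitive
    (fun _ _ => (integrable_oscillation hE hE' n).intervalIntegrable) c

/-- Hölder's inequality after inserting `v₁⁻¹ v₁`; only the derivative part of the Sobolev norm is
used. -/
theorem enorm_integral_mul_oscillation_le (hp : 1 < p) (hv₁ : LpLoc p v₁)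
    (hinv : InvLpLoc p.conjExponent v₁) (hc : 0 < c) (hcd : c < d) (hE : MeasurableSet E)
    (hsub : E ⊆ Icc c d) (hE0 : volume E ≠ 0) (hf : AbsolutelyContinuousOnInterval f c d) (n : ℕ) :
    ‖∫ x, f x * oscillation E n x ∂halfLine‖ₑ ≤
      primitiveNorm p v₁ E c d n * sobolevNorm p v₀ v₁ f := by
  have hpq := Real.HolderConjugate.conjExponent hp
  have hE' := volume_ne_top_of_subset_Icc hsub
  have hIoc : Ioc c d ⊆ Ioi 0 := fun x hx => hc.trans hx.1
  have hv₁m : AEMeasurable v₁ (volume.restrict (Ioc c d)) :=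
    ((hv₁ _ isCompact_Icc fun x hx => hc.trans_le hx.1).1.mono_measure
      (Measure.restrict_mono Ioc_subset_Icc_self le_rfl)).aemeasurable
  have hpos : ∀ᵐ x ∂volume.restrict (Ioc c d), 0 < v₁ x :=
    ae_mono (Measure.restrict_mono hIoc le_rfl) hinv.1
  set G : ℝ → ℝ := fun x => ∫ y in c..x, oscillation E n y with hG
  have hGm : Measurable G := (continuous_primitive_oscillation hE hE' n).measurable
  rw [integral_mul_oscillation_eq_neg hc hcd hE hsub hE0 hf n, enorm_neg,
    intervalIntegral.integral_of_le hcd.le]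
  calc ‖∫ x in Ioc c d, deriv f x * G x‖ₑ ≤ ∫⁻ x in Ioc c d, ‖deriv f x * G x‖ₑ :=
        enorm_integral_le_lintegral_enorm _
    _ = ∫⁻ x in Ioc c d, ((fun x => ‖(v₁ x)⁻¹ * G x‖ₑ) * fun x => ‖v₁ x * deriv f x‖ₑ) x := by
        refine lintegral_congr_ae (hpos.mono fun x hx => ?_)
        simp only [Pi.mul_apply]
        rw [← enorm_mul]
        congr 1
        field_simp
    _ ≤ (∫⁻ x in Ioc c d, ‖(v₁ x)⁻¹ * G x‖ₑ ^ p.conjExponent) ^ (1 / p.conjExponent) *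
        (∫⁻ x in Ioc c d, ‖v₁ x * deriv f x‖ₑ ^ p) ^ (1 / p) :=
        ENNReal.lintegral_mul_le_Lp_mul_Lq _ hpq.symm (hv₁m.inv.mul hGm.aemeasurable).enorm
          (hv₁m.mul (measurable_deriv f).aemeasurable).enorm
    _ ≤ _ := by
        refine mul_le_mul' (le_of_eq ?_) ?_
        · rw [primitiveNorm]
          congr 1
          refine lintegral_congr_ae (hpos.mono fun x hx => ?_)
          have hq := hpq.symm.nonneg
          simp only
          rw [← ENNReal.ofReal_mul (Real.rpow_nonneg hx.le _), ← ofReal_norm,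
            ENNReal.ofReal_rpow_of_nonneg (norm_nonneg _) hq, norm_mul,
            Real.mul_rpow (norm_nonneg _) (norm_nonneg _), Real.norm_of_nonneg (by positivity),
            Real.inv_rpow hx.le, Real.rpow_neg hx.le, Real.norm_eq_abs]
        · refine le_trans ?_ le_add_self
          rw [eLpNorm_eq_lintegral_rpow_enorm_toReal (ENNReal.ofReal_pos.2 hpq.pos).ne'
            ENNReal.ofReal_ne_top, ENNReal.toReal_ofReal hpq.nonneg]
          have := hpq.pos.le
          gcongr
          exact Measure.restrict_mono hIoc le_rfl

theorem weakFunctional_oscillation_le (hp : 1 < p) (hv₁ : LpLoc p v₁)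
    (hinv : InvLpLoc p.conjExponent v₁) (hc : 0 < c) (hcd : c < d) (hE : MeasurableSet E)
    (hsub : E ⊆ Icc c d) (hE0 : volume E ≠ 0) (n : ℕ) :
    weakFunctional (sobolevCompact p v₀ v₁) (sobolevNorm p v₀ v₁) (oscillation E n) ≤
      primitiveNorm p v₁ E c d n :=
  iSup₂_le fun _ hf => ENNReal.div_le_of_le_mul <|
    enorm_integral_mul_oscillation_le hp hv₁ hinv hc hcd hE hsub hE0 (hf.1.1 c d hc hcd) n

theorem abs_primitive_oscillation_le {x : ℝ} (hx : x ∈ Ioc c d) (n : ℕ) :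
    |∫ y in c..x, oscillation E n y| ≤ 2 * (d - c) := by
  have := intervalIntegral.norm_integral_le_of_norm_le_const (a := c) (b := x)
    (f := oscillation E n) (C := 2) fun y _ => abs_oscillation_le n y
  rw [abs_of_pos (sub_pos.2 hx.1), Real.norm_eq_abs] at this
  linarith [hx.2]

/-- The primitive at `x` is the pairing of the oscillation with the indicator of `(c, x]`, hence
tends to zero for each `x`. It is bounded by `2 (d - c)`, and `v₁^{-p'}` is integrable on `(c, d]`.
-/
theorem tendsto_primitiveNorm (hp : 1 < p) (hinv : InvLpLoc p.conjExponent v₁) (hc : 0 < c)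
    (hE : MeasurableSet E) (hsub : E ⊆ Icc c d) :
    Tendsto (primitiveNorm p v₁ E c d) atTop (𝓝 0) := by
  have hE' := volume_ne_top_of_subset_Icc hsub
  have hi := ((isRpowDensity_inv hp hinv).integrableOn_Icc (t := d) hc).mono_set Ioc_subset_Icc_self
  refine tendsto_weighted_lintegral_rpow (Real.HolderConjugate.conjExponent hp).symm.pos
    (C := 2 * (d - c)) hi.aemeasurable.ennreal_ofReal (Integrable.lintegral_lt_top hi).ne
    (fun n => (continuous_primitive_oscillation hE hE' n).measurable.aemeasurable)
    (fun n => (ae_restrict_mem measurableSet_Ioc).mono fun x hx =>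
      abs_primitive_oscillation_le hx n)
    ((ae_restrict_mem measurableSet_Ioc).mono fun x hx => ?_)
  have h := tendsto_integral_mul_oscillation hE hE' (h := (Ioc c x).indicator fun _ => 1)
    ((integrableOn_const hE').indicator measurableSet_Ioc)
  refine h.congr fun n => ?_
  rw [intervalIntegral.integral_of_le hx.1.le, ← integral_indicator measurableSet_Ioc]
  congr 1
  ext y
  by_cases hy : y ∈ Ioc c x <;> simp [hy]

theorem oscillation_mem_pairingDomain (hc : 0 < c) (hcd : c < d) (hE : MeasurableSet E)
    (hsub : E ⊆ Icc c d) (n : ℕ) :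
    oscillation E n ∈ pairingDomain (sobolevCompact p v₀ v₁) := by
  have hE' := volume_ne_top_of_subset_Icc hsub
  have hi := integrable_oscillation hE hE' n
  refine ⟨(measurable_oscillation hE n).aemeasurable, fun f hf => ?_⟩
  have hcont := (hf.1 c d hc hcd).continuousOn
  rw [uIcc_of_le hcd.le] at hcont
  obtain ⟨C, hC⟩ := isCompact_Icc.exists_bound_of_continuousOn hcont
  calc ∫⁻ x, ‖f x * oscillation E n x‖ₑ ∂halfLine
      ≤ ∫⁻ x, ENNReal.ofReal C * ‖oscillation E n x‖ₑ := by
        refine (setLIntegral_le_lintegral _ _).trans (lintegral_mono fun x => ?_)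
        by_cases hx : x ∈ Icc c d
        · rw [enorm_mul, ← ofReal_norm]
          gcongr
          exact hC x hx
        · rw [oscillation_eq_zero fun h => hx (hsub h)]
          simp
    _ = ENNReal.ofReal C * ∫⁻ x, ‖oscillation E n x‖ₑ :=
        lintegral_const_mul _ (measurable_oscillation hE n).enorm
    _ < ∞ := ENNReal.mul_lt_top ENNReal.ofReal_lt_top hi.2

theorem strongAssociate_weakAssociate (hp : 1 < p) (hv₁ : LpLoc p v₁)
    (hinv : InvLpLoc p.conjExponent v₁) :
    strongAssociate (weakAssociate (sobolevCompact p v₀ v₁) (sobolevNorm p v₀ v₁))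
      (weakFunctional (sobolevCompact p v₀ v₁) (sobolevNorm p v₀ v₁)) =
      {f : ℝ → ℝ | f =ᵐ[halfLine] 0} := by
  ext f
  constructor
  · rintro ⟨hfm, hf⟩
    by_contra h0
    have hpos : 0 < volume {x : ℝ | 0 < x ∧ f x ≠ 0} := by
      refine pos_iff_ne_zero.2 fun hz => h0 ?_
      rw [measure_eq_zero_iff_ae_notMem] at hz
      change ∀ᵐ x ∂halfLine, f x = 0
      rw [ae_restrict_iff' measurableSet_Ioi]
      filter_upwards [hz] with x hx hx0
      by_contra hne
      exact hx ⟨hx0, hne⟩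
    obtain ⟨c, d, δ, E, hc, hcd, hδ, hE, hsub, hE0, hfE⟩ := exists_set_le_abs hfm hpos
    have hE' := volume_ne_top_of_subset_Icc hsub
    obtain ⟨κ, hκ, hle⟩ := eventually_le_lintegral_mul_oscillation hδ hE hE' hE0
      (fun x hx => hc.trans_le (hsub hx).1) hfE
    have hlim := tendsto_of_tendsto_of_tendsto_of_le_of_le tendsto_const_nhds
      (tendsto_primitiveNorm hp hinv hc hE hsub) (fun _ => zero_le)
      (weakFunctional_oscillation_le (v₀ := v₀) hp hv₁ hinv hc hcd hE hsub hE0)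
    refine hf.ne (strongFunctional_eq_top hκ ?_ hle hlim)
    filter_upwards [hlim.eventually (gt_mem_nhds ENNReal.zero_lt_top)] with n hn
    exact ⟨oscillation_mem_pairingDomain hc hcd hE hsub n, hn⟩
  · intro hf
    have hf' : f =ᵐ[halfLine] 0 := hf
    refine ⟨aemeasurable_const.congr hf'.symm, ?_⟩
    refine lt_of_le_of_lt (iSup₂_le fun g _ => ?_) ENNReal.zero_lt_top
    rw [lintegral_congr_ae (g := fun _ => 0) ?_, lintegral_zero, ENNReal.zero_div]
    filter_upwards [hf'] with x hx
    simp [hx]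

end

/-! ### The norm of `𝒲` on the oscillations: kernels, their bounds and supports. -/

section

variable {p : ℝ} {v₀ v₁ f : ℝ → ℝ} {E : Set ℝ} {c d : ℝ}

/-- The standing assumptions on the weights. -/
structure Admissible (p : ℝ) (v₀ v₁ : ℝ → ℝ) : Prop where
  one_lt : 1 < p
  weight : IsWeight p v₀
  inv : InvLpLoc p.conjExponent v₁
  ends : BothEndsInfinite p v₀ v₁

/-- A measurable primitive of `v₁^{-p'}` on the half-line. -/
noncomputable def invPrimitive (p : ℝ) (v₁ : ℝ → ℝ) (x : ℝ) : ℝ :=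
  (Ioi 0).indicator (fun x => ∫ y in (1 : ℝ)..x, v₁ y ^ (-p.conjExponent)) x

/-- The function `a`, extended by zero to the whole line. -/
noncomputable def eqAExt (p : ℝ) (v₀ v₁ : ℝ → ℝ) (x : ℝ) : ℝ := (Ioi 0).indicator (eqA p v₀ v₁) x

namespace Admissible

theorem isEquilibriumPair (h : Admissible p v₀ v₁) {t : ℝ} (ht : 0 < t) :
    IsEquilibriumPair p v₀ v₁ t (eqA p v₀ v₁ t) (eqB p v₀ v₁ t) :=
  Classical.epsilon_spec (p := fun q : ℝ × ℝ => IsEquilibriumPair p v₀ v₁ t q.1 q.2)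
    (existsUnique_isEquilibriumPair h.one_lt h.weight h.inv h.ends ht).exists

theorem conj_pos (h : Admissible p v₀ v₁) : 0 < p.conjExponent :=
  (Real.HolderConjugate.conjExponent h.one_lt).symm.pos

theorem invDensity (h : Admissible p v₀ v₁) :
    PosLocDensity (fun x => v₁ x ^ (-p.conjExponent)) := posLocDensity_inv h.one_lt h.inv

theorem density (h : Admissible p v₀ v₁) : LocDensity (fun x => v₀ x ^ p) :=
  (isRpowDensity_rpow h.one_lt h.weight).locDensity

theorem mono (h : Admissible p v₀ v₁) {s t : ℝ} (hs : 0 < s) (hst : s ≤ t) :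
    eqA p v₀ v₁ s ≤ eqA p v₀ v₁ t ∧ eqB p v₀ v₁ s ≤ eqB p v₀ v₁ t :=
  EquilibriumPair.le_and_le h.conj_pos (zero_lt_one.trans h.one_lt) h.invDensity h.density hst
    (h.isEquilibriumPair hs) (h.isEquilibriumPair (hs.trans_le hst))

theorem eqA_pos (h : Admissible p v₀ v₁) {t : ℝ} (ht : 0 < t) : 0 < eqA p v₀ v₁ t :=
  (h.isEquilibriumPair ht).1

theorem eqA_lt (h : Admissible p v₀ v₁) {t : ℝ} (ht : 0 < t) : eqA p v₀ v₁ t < t :=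
  (h.isEquilibriumPair ht).2.1

theorem lt_eqB (h : Admissible p v₀ v₁) {t : ℝ} (ht : 0 < t) : t < eqB p v₀ v₁ t :=
  (h.isEquilibriumPair ht).2.2.1

theorem bigV_eq (h : Admissible p v₀ v₁) {t : ℝ} (ht : 0 < t) :
    bigV p v₀ v₁ t = 2 * ∫ y in (eqA p v₀ v₁ t)..t, v₁ y ^ (-p.conjExponent) := by
  have h1 := h.invDensity.add (h.eqA_pos ht) ht (ht.trans (h.lt_eqB ht))
  rw [bigV, ← h1, ← (h.isEquilibriumPair ht).2.2.2.1, two_mul]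

theorem bigV_pos (h : Admissible p v₀ v₁) {t : ℝ} (ht : 0 < t) : 0 < bigV p v₀ v₁ t :=
  h.invDensity.pos (h.eqA_pos ht) ((h.eqA_lt ht).trans (h.lt_eqB ht))

/-- For `x ∈ [c, d]` monotonicity gives `[a(x), b(x)] ⊆ [a(c), b(d)]`, so the `v₀`-factor is bounded
above by `K ^ (1 / p)`. As the product is one, `V₁(x)` is bounded below. No continuity of `a` and
`b` is needed. -/
theorem exists_le_bigV (h : Admissible p v₀ v₁) (hc : 0 < c) :
    ∃ m, 0 < m ∧ ∀ x ∈ Icc c d, m ≤ bigV p v₀ v₁ x := by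
  set K := ∫ y in (eqA p v₀ v₁ c)..(eqB p v₀ v₁ d), v₀ y ^ p with hK
  have hp0 : 0 < p := zero_lt_one.trans h.one_lt
  have key : ∀ x ∈ Icc c d, 1 ≤ bigV p v₀ v₁ x ^ (1 / p.conjExponent) * K ^ (1 / p) := by
    intro x hx
    have hx0 := hc.trans_le hx.1
    have hab := ((h.eqA_lt hx0).trans (h.lt_eqB hx0)).le
    refine (h.isEquilibriumPair hx0).2.2.2.2.symm.le.trans ?_
    refine mul_le_mul_of_nonneg_left ?_ (Real.rpow_nonneg (h.bigV_pos hx0).le _)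
    exact Real.rpow_le_rpow (h.density.nonneg (h.eqA_pos hx0) hab)
      (h.density.mono (h.eqA_pos hc) (h.mono hc hx.1).1 hab (h.mono hx0 hx.2).2)
      (one_div_pos.2 hp0).le
  by_cases hK0 : 0 < K ^ (1 / p)
  · refine ⟨((K ^ (1 / p))⁻¹) ^ p.conjExponent, by positivity, fun x hx => ?_⟩
    have hV := (h.bigV_pos (hc.trans_le hx.1)).le
    have h1 : (K ^ (1 / p))⁻¹ ≤ bigV p v₀ v₁ x ^ (1 / p.conjExponent) := by
      rw [inv_le_iff_one_le_mul₀ hK0]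
      exact key x hx
    refine (Real.rpow_le_rpow (by positivity) h1 h.conj_pos.le).trans_eq ?_
    rw [← Real.rpow_mul hV, one_div_mul_cancel h.conj_pos.ne', Real.rpow_one]
  -- By `key`, `Icc c d` is empty in this case, so any `m` would do.
  · refine ⟨1, one_pos, fun x hx => absurd (key x hx) (not_le.2 (lt_of_le_of_lt ?_ one_pos))⟩
    exact mul_nonpos_of_nonneg_of_nonpos
      (Real.rpow_nonneg (h.bigV_pos (hc.trans_le hx.1)).le _) (not_lt.1 hK0)

theorem bigV_le (h : Admissible p v₀ v₁) {s t : ℝ} (hs : 0 < s) (ht : t ∈ Icc s d) :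
    bigV p v₀ v₁ t ≤ 2 * ∫ y in (eqA p v₀ v₁ s)..d, v₁ y ^ (-p.conjExponent) := by
  have ht0 := hs.trans_le ht.1
  rw [h.bigV_eq ht0]
  have := h.invDensity.mono (h.eqA_pos hs) (h.mono hs ht.1).1 (h.eqA_lt ht0).le ht.2
  linarith

/-- Some `y > x` in the set defining the supremum has `a(y) < t`, and `a` is monotone. This places
`t` between `a(x)` and `x`, which gives both the kernel bound and the localisation in `t`. -/
theorem eqA_lt_of_mem (h : Admissible p v₀ v₁) {t x : ℝ} (ht : 0 < t)
    (hx : x ∈ forwardInterval p v₀ v₁ t) : eqA p v₀ v₁ x < t := by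
  obtain ⟨h1, h2⟩ := hx
  simp only [eqAInv, lt_iSup_iff] at h2
  obtain ⟨y, hy, hxy⟩ := h2
  exact (h.mono (ht.trans h1) (EReal.coe_lt_coe_iff.1 hxy).le).1.trans_lt hy.2

theorem measurable_invPrimitive (h : Admissible p v₀ v₁) : Measurable (invPrimitive p v₁) := by
  have := (h.invDensity.continuousOn one_pos).measurable_piecewise
    (g := fun _ => (0 : ℝ)) continuousOn_const measurableSet_Ioi
  exact this

theorem integral_eq (h : Admissible p v₀ v₁) {s t : ℝ} (hs : 0 < s) (ht : 0 < t) :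
    ∫ y in s..t, v₁ y ^ (-p.conjExponent) = invPrimitive p v₁ t - invPrimitive p v₁ s := by
  have := h.invDensity.add one_pos hs ht
  rw [invPrimitive, invPrimitive, indicator_of_mem (mem_Ioi.2 hs), indicator_of_mem (mem_Ioi.2 ht)]
  linarith

/-- Extension by zero keeps `a` monotone because `a > 0`, and monotone functions are measurable. -/
theorem measurable_eqAExt (h : Admissible p v₀ v₁) : Measurable (eqAExt p v₀ v₁) := by
  refine Monotone.measurable fun x y hxy => ?_
  unfold eqAExt
  by_cases hx : 0 < x
  · have hy := hx.trans_le hxy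
    rw [indicator_of_mem (mem_Ioi.2 hx), indicator_of_mem (mem_Ioi.2 hy)]
    exact (h.mono hx hxy).1
  · rw [indicator_of_notMem (by simpa using hx)]
    by_cases hy : 0 < y
    · rw [indicator_of_mem (mem_Ioi.2 hy)]
      exact (h.eqA_pos hy).le
    · rw [indicator_of_notMem (by simpa using hy)]

end Admissible

theorem measurable_eqAInv : Measurable (eqAInv p v₀ v₁) := by
  refine Monotone.measurable fun s t hst => ?_
  exact biSup_mono fun x hx => ⟨hx.1, hx.2.trans_le hst⟩

theorem measurableSet_forward :
    MeasurableSet {z : ℝ × ℝ | z.2 ∈ forwardInterval p v₀ v₁ z.1} := by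
  refine (measurableSet_lt measurable_fst measurable_snd).inter
    (measurableSet_lt ?_ (measurable_eqAInv.comp measurable_fst))
  exact measurable_coe_real_ereal.comp measurable_snd

theorem measurableSet_forwardInterval (t : ℝ) : MeasurableSet (forwardInterval p v₀ v₁ t) :=
  measurable_prodMk_left (x := t) measurableSet_forward

/-- A version of `∫_{a(x)}^{b(x)} v₁^{-p'}` that is measurable on the line. -/
noncomputable def bigVExt (p : ℝ) (v₀ v₁ : ℝ → ℝ) (x : ℝ) : ℝ :=
  2 * (invPrimitive p v₁ x - invPrimitive p v₁ (eqAExt p v₀ v₁ x))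

/-- The kernel of the inner integral of `𝔾`. -/
noncomputable def bbKernel (p : ℝ) (v₀ v₁ : ℝ → ℝ) (t x : ℝ) : ℝ :=
  (forwardInterval p v₀ v₁ t).indicator
    (fun x => (invPrimitive p v₁ t - invPrimitive p v₁ (eqAExt p v₀ v₁ x)) / bigVExt p v₀ v₁ x) x

/-- The kernel of the inner integral of `𝒢`. -/
noncomputable def calKernel (p : ℝ) (v₀ v₁ : ℝ → ℝ) (t x : ℝ) : ℝ :=
  (forwardInterval p v₀ v₁ t).indicator (fun x => (bigVExt p v₀ v₁ x)⁻¹) x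

namespace Admissible

theorem eqAExt_eq {x : ℝ} (hx : 0 < x) : eqAExt p v₀ v₁ x = eqA p v₀ v₁ x :=
  indicator_of_mem (mem_Ioi.2 hx) _

theorem bigVExt_eq (h : Admissible p v₀ v₁) {x : ℝ} (hx : 0 < x) :
    bigVExt p v₀ v₁ x = bigV p v₀ v₁ x := by
  rw [h.bigV_eq hx, h.integral_eq (h.eqA_pos hx) hx, bigVExt, eqAExt_eq hx]

theorem measurable_bigVExt (h : Admissible p v₀ v₁) : Measurable (bigVExt p v₀ v₁) :=
  (h.measurable_invPrimitive.sub
    (h.measurable_invPrimitive.comp h.measurable_eqAExt)).const_mul 2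

theorem measurable_bbKernel (h : Admissible p v₀ v₁) :
    Measurable (Function.uncurry (bbKernel p v₀ v₁)) := by
  have : Measurable fun z : ℝ × ℝ =>
      (invPrimitive p v₁ z.1 - invPrimitive p v₁ (eqAExt p v₀ v₁ z.2)) / bigVExt p v₀ v₁ z.2 :=
    ((h.measurable_invPrimitive.comp measurable_fst).sub
      ((h.measurable_invPrimitive.comp h.measurable_eqAExt).comp measurable_snd)).div
      (h.measurable_bigVExt.comp measurable_snd)
  exact this.indicator measurableSet_forward

theorem measurable_calKernel (h : Admissible p v₀ v₁) :
    Measurable (Function.uncurry (calKernel p v₀ v₁)) :=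
  (h.measurable_bigVExt.comp measurable_snd).inv.indicator measurableSet_forward

theorem bbKernel_mul (h : Admissible p v₀ v₁) {t : ℝ} (ht : 0 < t) (g : ℝ → ℝ) (x : ℝ) :
    bbKernel p v₀ v₁ t x * g x =
      (forwardInterval p v₀ v₁ t).indicator (bbIntegrand p v₀ v₁ g t) x := by
  by_cases hx : x ∈ forwardInterval p v₀ v₁ t
  · have hx0 := ht.trans hx.1
    rw [bbKernel, indicator_of_mem hx, indicator_of_mem hx, bbIntegrand, eqAExt_eq hx0,
      h.bigVExt_eq hx0, h.integral_eq (h.eqA_pos hx0) ht]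
    ring
  · rw [bbKernel, indicator_of_notMem hx, indicator_of_notMem hx, zero_mul]

theorem calKernel_mul (h : Admissible p v₀ v₁) {t : ℝ} (ht : 0 < t) (g : ℝ → ℝ) (x : ℝ) :
    calKernel p v₀ v₁ t x * g x =
      (forwardInterval p v₀ v₁ t).indicator (calIntegrand p v₀ v₁ g) x := by
  by_cases hx : x ∈ forwardInterval p v₀ v₁ t
  · rw [calKernel, indicator_of_mem hx, indicator_of_mem hx, calIntegrand,
      h.bigVExt_eq (ht.trans hx.1)]
    ring
  · rw [calKernel, indicator_of_notMem hx, indicator_of_notMem hx, zero_mul]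

/-- On the forward interval `a(x) < t < x < b(x)`, so the numerator is part of the integral that
defines `V₁(x)`. -/
theorem abs_bbKernel_le (h : Admissible p v₀ v₁) {t : ℝ} (ht : 0 < t) (x : ℝ) :
    |bbKernel p v₀ v₁ t x| ≤ 1 := by
  by_cases hx : x ∈ forwardInterval p v₀ v₁ t
  · have hx0 := ht.trans hx.1
    have hlt := h.eqA_lt_of_mem ht hx
    have ha := h.eqA_pos hx0
    rw [bbKernel, indicator_of_mem hx, h.bigVExt_eq hx0, eqAExt_eq hx0, ← h.integral_eq ha ht,
      abs_div, abs_of_pos (h.bigV_pos hx0), abs_of_pos (h.invDensity.pos ha hlt),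
      div_le_one (h.bigV_pos hx0)]
    exact h.invDensity.mono ha le_rfl hlt.le (hx.1.trans (h.lt_eqB hx0)).le
  · rw [bbKernel, indicator_of_notMem hx]
    simp

theorem abs_calKernel_le (h : Admissible p v₀ v₁) {t m x : ℝ} (hx0 : 0 < x) (hm : 0 < m)
    (hmx : m ≤ bigV p v₀ v₁ x) : |calKernel p v₀ v₁ t x| ≤ m⁻¹ := by
  by_cases hx : x ∈ forwardInterval p v₀ v₁ t
  · rw [calKernel, indicator_of_mem hx, h.bigVExt_eq hx0, abs_inv, abs_of_pos (h.bigV_pos hx0)]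
    gcongr
  · rw [calKernel, indicator_of_notMem hx, abs_zero]
    positivity

end Admissible

/-! ### Oscillations against bounded kernels -/

section kernel
variable {H : ℝ → ℝ → ℝ} {C r : ℝ} {S : Set ℝ} {φ : ℝ → ℝ}

theorem integrable_kernel_mul_oscillation (hE : MeasurableSet E) (hE' : volume E ≠ ∞)
    (hH : Measurable (Function.uncurry H)) {t : ℝ} (hC : ∀ x ∈ E, |H t x| ≤ C) (n : ℕ) :
    Integrable fun x => H t x * oscillation E n x := by
  refine ((integrable_oscillation hE hE' n).abs.const_mul C).mono'
    ((hH.comp measurable_prodMk_left).mul (measurable_oscillation hE n)).aestronglyMeasurable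
    (Eventually.of_forall fun x => ?_)
  by_cases hx : x ∈ E
  · rw [Real.norm_eq_abs, abs_mul]
    gcongr
    exact hC x hx
  · simp [oscillation_eq_zero hx]

/-- For fixed `t` the inner integral tends to zero, since `H t` is integrable on `E` and the
oscillations are weakly null; it is bounded by `2 C |E|`. As it vanishes for `t ∉ S`, the integrable
weight on `S` gives the dominating function. -/
theorem tendsto_kernel_functional (hr : 0 < r) (hE : MeasurableSet E) (hE' : volume E ≠ ∞)
    (hH : Measurable (Function.uncurry H)) (hC : ∀ t, 0 < t → ∀ x ∈ E, |H t x| ≤ C)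
    (hS : MeasurableSet S) (hφ : IntegrableOn φ S)
    (hHS : ∀ t, 0 < t → t ∉ S → ∀ x ∈ E, H t x = 0) :
    Tendsto (fun n => (∫⁻ t, ENNReal.ofReal (φ t * |∫ x, H t x * oscillation E n x| ^ r)
      ∂halfLine) ^ (1 / r)) atTop (𝓝 0) := by
  have hφ' : Integrable (S.indicator φ) halfLine := ((integrable_indicator_iff hS).2 hφ).restrict
  have hpos : ∀ᵐ t ∂halfLine, 0 < t := ae_restrict_mem measurableSet_Ioi
  have h := tendsto_weighted_lintegral_rpow (μ := halfLine) hr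
    (φ := fun t => ENNReal.ofReal (S.indicator φ t))
    (k := fun n t => ∫ x, H t x * oscillation E n x) (C := C * 2 * volume.real E)
    hφ'.aemeasurable.ennreal_ofReal hφ'.lintegral_lt_top.ne
    (fun n => (StronglyMeasurable.integral_prod_right (f := fun t x => H t x * oscillation E n x)
      (hH.mul ((measurable_oscillation hE n).comp
        measurable_snd)).stronglyMeasurable).measurable.aemeasurable)
    (fun n => hpos.mono fun t ht => by
      have e : ∫ x in E, H t x * oscillation E n x = ∫ x, H t x * oscillation E n x :=
        setIntegral_eq_integral_of_forall_compl_eq_zero fun x hx => by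
          rw [oscillation_eq_zero hx, mul_zero]
      rw [← e, ← Real.norm_eq_abs]
      refine norm_setIntegral_le_of_norm_le_const (lt_top_iff_ne_top.2 hE') fun x hx => ?_
      rw [norm_mul]
      exact mul_le_mul (hC t ht x hx) (abs_oscillation_le n x) (norm_nonneg _)
        ((abs_nonneg _).trans (hC t ht x hx)))
    (hpos.mono fun t ht => tendsto_integral_mul_oscillation hE hE'
      (Measure.integrableOn_of_bounded hE' (hH.comp measurable_prodMk_left).aestronglyMeasurable
        ((ae_restrict_mem hE).mono (hC t ht))))
  refine h.congr fun n => ?_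
  congr 1
  refine lintegral_congr_ae (hpos.mono fun t ht => ?_)
  simp only
  rw [← ENNReal.ofReal_mul' (by positivity)]
  by_cases hS' : t ∈ S
  · rw [indicator_of_mem hS']
  · have : ∀ x, H t x * oscillation E n x = 0 := fun x => by
      by_cases hx : x ∈ E
      · rw [hHS t ht hS' x hx, zero_mul]
      · rw [oscillation_eq_zero hx, mul_zero]
    simp [this, Real.zero_rpow hr.ne']

end kernel

namespace Admissible

/-- A point `x ∈ [c, d]` of the forward interval satisfies `a(c) ≤ a(x) < t < x ≤ d`. Hence the
outer integrals live on the compact interval `[a(c), d]` of the half-line. -/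
theorem notMem_forwardInterval (h : Admissible p v₀ v₁) (hc : 0 < c) {t x : ℝ} (ht : 0 < t)
    (htS : t ∉ Icc (eqA p v₀ v₁ c) d) (hx : x ∈ Icc c d) : x ∉ forwardInterval p v₀ v₁ t :=
  fun hxt => htS ⟨(h.mono hc hx.1).1.trans (h.eqA_lt_of_mem ht hxt).le, hxt.1.le.trans hx.2⟩

theorem integrableOn_Icc (h : Admissible p v₀ v₁) {s : ℝ} (hs : 0 < s) :
    IntegrableOn (fun x => v₁ x ^ (-p.conjExponent)) (Icc s d) :=
  (isRpowDensity_inv h.one_lt h.inv).integrableOn_Icc hs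

theorem tendsto_bbG_oscillation (h : Admissible p v₀ v₁) (hc : 0 < c) (hE : MeasurableSet E)
    (hsub : E ⊆ Icc c d) :
    Tendsto (fun n => bbG p v₀ v₁ (oscillation E n)) atTop (𝓝 0) := by
  have hE' := volume_ne_top_of_subset_Icc hsub
  refine (tendsto_kernel_functional h.conj_pos hE hE' h.measurable_bbKernel
    (fun t ht x _ => h.abs_bbKernel_le ht x) measurableSet_Icc
    (h.integrableOn_Icc (d := d) (h.eqA_pos hc)) fun t ht htS x hx =>
      indicator_of_notMem (h.notMem_forwardInterval hc ht htS (hsub hx)) _).congr fun n => ?_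
  rw [bbG]
  congr 1
  refine setLIntegral_congr_fun measurableSet_Ioi fun t ht => ?_
  simp only [h.bbKernel_mul ht, integral_indicator (measurableSet_forwardInterval t)]

theorem tendsto_calG_oscillation (h : Admissible p v₀ v₁) (hc : 0 < c) (hE : MeasurableSet E)
    (hsub : E ⊆ Icc c d) :
    Tendsto (fun n => calG p v₀ v₁ (oscillation E n)) atTop (𝓝 0) := by
  have hE' := volume_ne_top_of_subset_Icc hsub
  have ha := h.eqA_pos hc
  obtain ⟨m, hm, hmV⟩ := h.exists_le_bigV (d := d) hc
  have hφ : IntegrableOn (fun t => v₁ t ^ (-p.conjExponent) * bigVExt p v₀ v₁ t ^ p.conjExponent)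
      (Icc (eqA p v₀ v₁ c) d) := by
    -- The variable `t` starts at `a(c)`, so bounding `V₁(t)` reaches one step further left, to
    -- `a(a(c))`.
    refine (h.integrableOn_Icc ha).mul_bdd
      (c := (2 * ∫ y in (eqA p v₀ v₁ (eqA p v₀ v₁ c))..d, v₁ y ^ (-p.conjExponent)) ^
        p.conjExponent) (h.measurable_bigVExt.pow_const _).aestronglyMeasurable
      ((ae_restrict_mem measurableSet_Icc).mono fun t ht => ?_)
    have ht0 := ha.trans_le ht.1
    have hV := (h.bigV_pos ht0).le
    rw [h.bigVExt_eq ht0, Real.norm_of_nonneg (Real.rpow_nonneg hV _)]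
    exact Real.rpow_le_rpow hV (h.bigV_le ha ht) h.conj_pos.le
  refine (tendsto_kernel_functional h.conj_pos hE hE' h.measurable_calKernel
    (fun t _ x hx => h.abs_calKernel_le (hc.trans_le (hsub hx).1) hm (hmV x (hsub hx)))
    measurableSet_Icc hφ fun t ht htS x hx =>
      indicator_of_notMem (h.notMem_forwardInterval hc ht htS (hsub hx)) _).congr fun n => ?_
  rw [calG]
  congr 1
  refine setLIntegral_congr_fun measurableSet_Ioi fun t ht => ?_
  simp only [h.calKernel_mul ht, integral_indicator (measurableSet_forwardInterval t),
    h.bigVExt_eq ht]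

theorem strongFunctional_scrW (h : Admissible p v₀ v₁) (hf : AEMeasurable f halfLine)
    (h0 : 0 < volume {x : ℝ | 0 < x ∧ f x ≠ 0}) :
    strongFunctional (scrW p v₀ v₁) (scrWNorm p v₀ v₁) f = ∞ := by
  obtain ⟨c, d, δ, E, hc, hcd, hδ, hE, hsub, hE0, hfE⟩ := exists_set_le_abs hf h0
  have hE' := volume_ne_top_of_subset_Icc hsub
  obtain ⟨κ, hκ, hle⟩ := eventually_le_lintegral_mul_oscillation hδ hE hE' hE0
    (fun x hx => hc.trans_le (hsub hx).1) hfE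
  have hlim : Tendsto (fun n => scrWNorm p v₀ v₁ (oscillation E n)) atTop (𝓝 0) := by
    simpa [scrWNorm] using (h.tendsto_bbG_oscillation hc hE hsub).add (h.tendsto_calG_oscillation hc hE hsub)
  refine strongFunctional_eq_top hκ ?_ hle hlim
  filter_upwards [hlim.eventually (gt_mem_nhds ENNReal.zero_lt_top)] with n hn
  -- The inner integrals exist even if the forward interval is unbounded, because the oscillation is
  -- supported in `E` and the kernels are bounded there.
  refine ⟨(integrable_oscillation hE hE' n).locallyIntegrable.locallyIntegrableOn _,
    fun t ht => ⟨?_, ?_⟩, hn⟩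
  · rw [← integrable_indicator_iff (measurableSet_forwardInterval t)]
    refine (integrable_kernel_mul_oscillation hE hE' h.measurable_bbKernel
      (fun x _ => h.abs_bbKernel_le ht x) n).congr (Eventually.of_forall fun x => ?_)
    exact h.bbKernel_mul ht _ x
  · obtain ⟨m, hm, hmV⟩ := h.exists_le_bigV (d := d) hc
    rw [← integrable_indicator_iff (measurableSet_forwardInterval t)]
    refine (integrable_kernel_mul_oscillation (t := t) hE hE' h.measurable_calKernel
      (fun x hx => h.abs_calKernel_le (hc.trans_le (hsub hx).1) hm (hmV x (hsub hx))) n).congr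
      (Eventually.of_forall fun x => ?_)
    exact h.calKernel_mul ht _ x

end Admissible

end

end WeightedSobolev

theorem mainTheorem2 (p : ℝ) (hp : 1 < p) (v₀ v₁ : ℝ → ℝ)
    (hv₀ : WeightedSobolev.IsWeight p v₀) (hv₁ : WeightedSobolev.IsWeight p v₁)
    (hinv : WeightedSobolev.InvLpLoc p.conjExponent v₁)
    (hends : WeightedSobolev.BothEndsInfinite p v₀ v₁) :
    (∀ t : ℝ, 0 < t → ∃! q : ℝ × ℝ, WeightedSobolev.IsEquilibriumPair p v₀ v₁ t q.1 q.2) ∧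
    (∀ f : ℝ → ℝ, AEMeasurable f WeightedSobolev.halfLine →
      0 < volume {x : ℝ | 0 < x ∧ f x ≠ 0} →
      WeightedSobolev.strongFunctional (WeightedSobolev.scrW p v₀ v₁)
        (WeightedSobolev.scrWNorm p v₀ v₁) f = ∞) ∧
    WeightedSobolev.strongAssociate
        (WeightedSobolev.weakAssociate (WeightedSobolev.sobolevCompact p v₀ v₁)
          (WeightedSobolev.sobolevNorm p v₀ v₁))
        (WeightedSobolev.weakFunctional (WeightedSobolev.sobolevCompact p v₀ v₁)
          (WeightedSobolev.sobolevNorm p v₀ v₁)) =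
      {f : ℝ → ℝ | f =ᵐ[WeightedSobolev.halfLine] 0} :=
  ⟨fun _ ht => WeightedSobolev.existsUnique_isEquilibriumPair hp hv₀ hinv hends ht,
    fun _ hf h0 => WeightedSobolev.Admissible.strongFunctional_scrW ⟨hp, hv₀, hinv, hends⟩ hf h0,
    WeightedSobolev.strongAssociate_weakAssociate hp hv₁.1 hinv⟩
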